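/- Let $p$ be a prime, let $r>1$ be real, and let $B=\{z\in\mathbb C_p:|z|\le r\}$. Let $R_B$ be the set of rational functions over $\mathbb C_p$ without poles in $B$, with the topology given by the norm $\|f\|_B=\sup_{i\ge 0}|a_i|r^i$, where $f(z)=\sum_{i\ge 0}a_iz^i$ is the power series expansion of $f$ at $0$. For $f\in R_B$ let $K(f,B)=\{z\in B: f^n(z)\in B\text{ for all }n\ge 0\}$ be its filled Julia set in $B$. A disc is an open or closed ball of $\mathbb C_p$ with radius in $|\mathbb C_p^*|$; a set $D\subseteq K(f,B)$ is wandering if $f^n(D)\cap f^m(D)\neq\emptyset$ only when $n=m$ $(n,m\ge 0)$. Let $R_B^E$ be the set of those $f\in R_B$ that have a wandering disc $D\subseteq K(f,B)$ which is not attracted to an attracting cycle, i.e. for no point $z\in D$ is the orbit of $z$ asymptotic to the orbit of a point $w\in K(f,B)$ with $f^k(w)=w$ and $|(f^k)'(w)|<1$ for some $k\ge 1$. For every $\lambda\in\Lambda=\{\lambda\in\mathbb C_p:|\lambda-1|<1\}$, the polynomial $$P_\lambda(z)=\frac{\lambda}{p}z^p+\Bigl(1-\frac{\lambda}{p}\Bigr)z^{p+1}$$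 belongs to the interior of the closure $\overline{R_B^E}$ in $R_B$. -/

import Mathlib

open scoped ENNReal Topology

noncomputable section

/-- A disc of `ℂ_p`: an open or closed ball whose radius is a value `|c|`, `c ≠ 0`. -/
def IsDisc {p : ℕ} [Fact p.Prime] (D : Set ℂ_[p]) : Prop :=
  ∃ a c : ℂ_[p], c ≠ 0 ∧ (D = Metric.ball a ‖c‖ ∨ D = Metric.closedBall a ‖c‖)

/-- `R_B` for `B = {z : |z| ≤ r}`: the rational functions over `ℂ_p` without poles in `B`
(`RatFunc.denom` is the denominator in lowest terms). -/
def RegularRatFunc (p : ℕ) [Fact p.Prime] (r : ℝ) : Type :=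
  {f : RatFunc ℂ_[p] // ∀ z : ℂ_[p], ‖z‖ ≤ r → f.denom.eval z ≠ 0}

namespace RegularRatFunc

variable {p : ℕ} [Fact p.Prime] {r : ℝ}

/-- The function `z ↦ f z`. (Its value at a pole is `0`; such points are outside `B`.) -/
def toFun (f : RegularRatFunc p r) (z : ℂ_[p]) : ℂ_[p] :=
  f.1.eval (RingHom.id ℂ_[p]) z

/-- The power series expansion of `f` at `0`, that is `num / denom` computed in `ℂ_p⟦X⟧`. For
`r ≥ 0` the denominator does not vanish at `0`, so that it is invertible there. -/
def expansion (f : RegularRatFunc p r) : PowerSeries ℂ_[p] :=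
  (f.1.num : PowerSeries ℂ_[p]) * (f.1.denom : PowerSeries ℂ_[p])⁻¹

end RegularRatFunc

/-- The norm `‖∑ aᵢ zⁱ‖_B = sup_i |aᵢ| rⁱ`, as an element of `[0, ∞]`. -/
def ballNorm {p : ℕ} [Fact p.Prime] (r : ℝ) (φ : PowerSeries ℂ_[p]) : ℝ≥0∞ :=
  ⨆ i : ℕ, ‖PowerSeries.coeff i φ‖ₑ * ENNReal.ofReal r ^ i

theorem ballNorm_add_le {p : ℕ} [Fact p.Prime] (r : ℝ) (φ ψ : PowerSeries ℂ_[p]) :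
    ballNorm r (φ + ψ) ≤ ballNorm r φ + ballNorm r ψ := by
  refine iSup_le fun i => ?_
  rw [map_add]
  calc ‖PowerSeries.coeff i φ + PowerSeries.coeff i ψ‖ₑ * ENNReal.ofReal r ^ i
      ≤ (‖PowerSeries.coeff i φ‖ₑ + ‖PowerSeries.coeff i ψ‖ₑ) * ENNReal.ofReal r ^ i := by
        gcongr
        exact enorm_add_le _ _
    _ = ‖PowerSeries.coeff i φ‖ₑ * ENNReal.ofReal r ^ i
          + ‖PowerSeries.coeff i ψ‖ₑ * ENNReal.ofReal r ^ i := add_mul _ _ _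
    _ ≤ ballNorm r φ + ballNorm r ψ :=
        add_le_add (le_iSup (fun i => ‖PowerSeries.coeff i φ‖ₑ * ENNReal.ofReal r ^ i) i)
          (le_iSup (fun i => ‖PowerSeries.coeff i ψ‖ₑ * ENNReal.ofReal r ^ i) i)

theorem ballNorm_neg {p : ℕ} [Fact p.Prime] (r : ℝ) (φ : PowerSeries ℂ_[p]) :
    ballNorm r (-φ) = ballNorm r φ := by
  simp [ballNorm]

/-- The distance `‖f - g‖_B` on `R_B`, which gives `R_B` its topology. -/
instance RegularRatFunc.instPseudoEMetricSpace {p : ℕ} [Fact p.Prime] {r : ℝ} :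
    PseudoEMetricSpace (RegularRatFunc p r) where
  edist f g := ballNorm r (f.expansion - g.expansion)
  edist_self f := by simp [ballNorm]
  edist_comm f g := by
    rw [← ballNorm_neg, neg_sub]
  edist_triangle f g h := by
    rw [← sub_add_sub_cancel f.expansion g.expansion h.expansion]
    exact ballNorm_add_le _ _ _

namespace RegularRatFunc

variable {p : ℕ} [Fact p.Prime] {r : ℝ}

/-- The filled Julia set `K(f, B)`: the points of `B` whose whole orbit stays in `B`. -/
def filledJulia (f : RegularRatFunc p r) : Set ℂ_[p] :=
  {z | ∀ n : ℕ, ‖f.toFun^[n] z‖ ≤ r}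

/-- `z` is a periodic point (with orbit in `B`) of an attracting cycle:
`f^k(z) = z` and `|(f^k)'(z)| < 1` for some `k ≥ 1`. -/
def IsAttractingPeriodic (f : RegularRatFunc p r) (z : ℂ_[p]) : Prop :=
  z ∈ f.filledJulia ∧ ∃ k : ℕ, 1 ≤ k ∧ f.toFun^[k] z = z ∧ ‖deriv (f.toFun^[k]) z‖ < 1

/-- The points attracted to some attracting cycle: the orbit of `z` is asymptotic to the
orbit of a point `w` of the cycle. -/
def attractingBasin (f : RegularRatFunc p r) : Set ℂ_[p] :=
  {z | ∃ w, f.IsAttractingPeriodic w ∧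
    Filter.Tendsto (fun n : ℕ => ‖f.toFun^[n] z - f.toFun^[n] w‖) Filter.atTop (𝓝 0)}

/-- A wandering set: `f^n(D)` and `f^m(D)` meet only when `n = m`. -/
def IsWandering (f : RegularRatFunc p r) (D : Set ℂ_[p]) : Prop :=
  ∀ n m : ℕ, ((f.toFun^[n] '' D) ∩ (f.toFun^[m] '' D)).Nonempty → n = m

/-- `R_B^E`: the functions in `R_B` that have a wandering disc contained in the filled Julia
set and not attracted to an attracting cycle. -/
def withWanderingDisc (p : ℕ) [Fact p.Prime] (r : ℝ) : Set (RegularRatFunc p r) :=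
  {f | ∃ D : Set ℂ_[p], IsDisc D ∧ D ⊆ f.filledJulia ∧ f.IsWandering D ∧
    Disjoint D f.attractingBasin}

end RegularRatFunc

/-- `P_λ(z) = (λ/p) z^p + (1 - λ/p) z^(p+1)`. -/
def benedettoPoly (p : ℕ) [Fact p.Prime] (lam : ℂ_[p]) : Polynomial ℂ_[p] :=
  Polynomial.C (lam / p) * Polynomial.X ^ p + Polynomial.C (1 - lam / p) * Polynomial.X ^ (p + 1)

/-- `P_λ` as an element of `R_B`. -/
def benedettoMap (p : ℕ) [Fact p.Prime] (r : ℝ) (lam : ℂ_[p]) : RegularRatFunc p r :=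
  ⟨algebraMap (Polynomial ℂ_[p]) (RatFunc ℂ_[p]) (benedettoPoly p lam), fun z _ => by
    rw [RatFunc.denom_algebraMap]
    simp⟩

end

/-! It suffices that every f within p⁻² of P_λ is a limit of maps having such a disc. On the unit
ball such an f keeps the metric behaviour of P_λ (`TameMap`): it multiplies distances by exactly p
on the open unit disc about 1, satisfies |f(z)| = p|z|^p for |z| < 1 unless this is at most p⁻², and
has local Lipschitz factor t_k on the circle |z| = t_{k+1}, where t_0 = 1 and p t_{k+1}^p = t_k. It
also has a repelling fixed point β near 1 (`exists_fixed`). The perturbations are g_c = f + c z(z -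
β), all fixing β (`exists_tameFamily`).

An orbit that stays near β for m steps expands discs by about p^m. If it then passes close to 0 and
climbs back through the circles of radii t_M, ..., t_1, 1, the climb contracts, and for large M this
outweighs the expansion. Parameters producing such an itinerary are found because a rational
function on a ball attains y unless its distance to y is constant (`IsRatOn.exists_eq`). The
induction `Stage.exists_next` appends a longer stay near β and a compensating climb, moving the
parameter ever less.

In the limit (`Stage.exists_limit`) the images of a fixed disc keep diameter less than 1, and its
itinerary with respect to the open unit ball has arbitrarily long stays of norm 1, each of which
ends. Such an itinerary is not eventually periodic, which rules out both a meeting of two images and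
attraction to a cycle (`mem_withWanderingDisc`). -/

noncomputable section

/-! ### Ultrametric norms and values of rational functions on balls. -/

namespace Ultra

section Norm

variable {K : Type*} [NormedField K] [IsUltrametricDist K]

theorem norm_add_eq_left_of_lt {x y : K} (h : ‖y‖ < ‖x‖) : ‖x + y‖ = ‖x‖ := by
  rw [IsUltrametricDist.norm_add_eq_max_of_norm_ne_norm h.ne', max_eq_left h.le]

theorem norm_eq_of_norm_sub_lt {x y : K} (h : ‖x - y‖ < ‖x‖) : ‖y‖ = ‖x‖ := by
  have := norm_add_eq_left_of_lt (x := x) (y := -(x - y)) (by rwa [norm_neg])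
  rwa [show x + -(x - y) = y by ring] at this

theorem norm_add_le_of_le {x y : K} {R : ℝ} (hx : ‖x‖ ≤ R) (hy : ‖y‖ ≤ R) : ‖x + y‖ ≤ R :=
  (IsUltrametricDist.norm_add_le_max x y).trans (max_le hx hy)

theorem norm_sub_le_of_le {x y : K} {R : ℝ} (hx : ‖x‖ ≤ R) (hy : ‖y‖ ≤ R) : ‖x - y‖ ≤ R := by
  rw [sub_eq_add_neg]
  exact norm_add_le_of_le hx (by rwa [norm_neg])

theorem norm_sub_le_of_norm_sub_le {x y z : K} {R : ℝ} (hx : ‖x - y‖ ≤ R) (hy : ‖y - z‖ ≤ R) :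
    ‖x - z‖ ≤ R := by
  rw [← sub_add_sub_cancel x y z]
  exact norm_add_le_of_le hx hy

theorem norm_add_lt_of_lt {x y : K} {R : ℝ} (hx : ‖x‖ < R) (hy : ‖y‖ < R) : ‖x + y‖ < R :=
  (IsUltrametricDist.norm_add_le_max x y).trans_lt (max_lt hx hy)

/-- On a ball without roots a polynomial has constant norm. -/
theorem norm_eval_eq_of_forall_ne_zero [IsAlgClosed K] (Q : Polynomial K) {a z : K}
    {R : ℝ} (h : ∀ w, ‖w - a‖ ≤ R → Q.eval w ≠ 0) (hz : ‖z - a‖ ≤ R) :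
    ‖Q.eval z‖ = ‖Q.eval a‖ := by
  have key : ∀ w : K, ‖Q.eval w‖ = ‖Q.leadingCoeff‖ * (Q.roots.map fun r => ‖w - r‖).prod := by
    intro w
    conv_lhs => rw [(IsAlgClosed.splits Q).eq_prod_roots]
    rw [Polynomial.eval_mul, Polynomial.eval_C, norm_mul, Polynomial.eval_multiset_prod]
    congr 1
    refine (map_multiset_prod (normHom : K →*₀ ℝ) _).trans ?_
    simp [Multiset.map_map, normHom]
  rw [key, key]
  congr 2
  refine Multiset.map_congr rfl fun r hr => ?_
  have hroot : Q.eval r = 0 := Polynomial.isRoot_of_mem_roots hr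
  have hfar : R < ‖r - a‖ := by
    by_contra! hle
    exact h r hle hroot
  have hlt : ‖z - a‖ < ‖a - r‖ := by
    rw [norm_sub_rev a r]
    exact hz.trans_lt hfar
  rw [← norm_add_eq_left_of_lt hlt]
  congr 1
  ring

end Norm

variable {K : Type*} [NormedField K]

/-- `φ` agrees on `S` with a rational function without poles in `S`. -/
def IsRatOn (S : Set K) (φ : K → K) : Prop :=
  ∃ A B : Polynomial K, ∀ c ∈ S, B.eval c ≠ 0 ∧ φ c = A.eval c / B.eval c

namespace IsRatOn

variable {S : Set K} {φ ψ : K → K}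

theorem congr (h : IsRatOn S φ) (he : ∀ c ∈ S, ψ c = φ c) : IsRatOn S ψ := by
  obtain ⟨A, B, hAB⟩ := h
  exact ⟨A, B, fun c hc => ⟨(hAB c hc).1, (he c hc).trans (hAB c hc).2⟩⟩

theorem polynomial (S : Set K) (A : Polynomial K) : IsRatOn S fun c => A.eval c :=
  ⟨A, 1, fun c _ => by simp⟩

theorem const (S : Set K) (a : K) : IsRatOn S fun _ => a := by
  simpa using polynomial S (Polynomial.C a)

theorem id (S : Set K) : IsRatOn S fun c => c := by
  simpa using polynomial S Polynomial.X

theorem add (h : IsRatOn S φ) (h' : IsRatOn S ψ) : IsRatOn S fun c => φ c + ψ c := by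
  obtain ⟨A, B, hAB⟩ := h
  obtain ⟨A', B', hAB'⟩ := h'
  refine ⟨A * B' + B * A', B * B', fun c hc => ?_⟩
  obtain ⟨h1, h2⟩ := hAB c hc
  obtain ⟨h3, h4⟩ := hAB' c hc
  refine ⟨by simp [h1, h3], ?_⟩
  simp only [h2, h4, Polynomial.eval_add, Polynomial.eval_mul]
  exact div_add_div _ _ h1 h3

theorem mul (h : IsRatOn S φ) (h' : IsRatOn S ψ) : IsRatOn S fun c => φ c * ψ c := by
  obtain ⟨A, B, hAB⟩ := h
  obtain ⟨A', B', hAB'⟩ := h'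
  refine ⟨A * A', B * B', fun c hc => ?_⟩
  obtain ⟨h1, h2⟩ := hAB c hc
  obtain ⟨h3, h4⟩ := hAB' c hc
  refine ⟨by simp [h1, h3], ?_⟩
  simp only [h2, h4, Polynomial.eval_mul]
  exact div_mul_div_comm _ _ _ _

theorem inv (h : IsRatOn S φ) (h0 : ∀ c ∈ S, φ c ≠ 0) : IsRatOn S fun c => (φ c)⁻¹ := by
  obtain ⟨A, B, hAB⟩ := h
  refine ⟨B, A, fun c hc => ?_⟩
  obtain ⟨h1, h2⟩ := hAB c hc
  refine ⟨fun hA => h0 c hc (by rw [h2, hA, zero_div]), ?_⟩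
  simp only [h2, inv_div]

theorem eval_comp (h : IsRatOn S φ) (Q : Polynomial K) : IsRatOn S fun c => Q.eval (φ c) := by
  induction Q using Polynomial.induction_on' with
  | add P Q hP hQ => simpa only [Polynomial.eval_add] using hP.add hQ
  | monomial n a =>
    simp only [Polynomial.eval_monomial]
    refine IsRatOn.mul (const S a) ?_
    induction n with
    | zero => simpa using polynomial S 1
    | succ n ih => simpa only [pow_succ] using ih.mul h

/-- A rational function on a ball takes every value from which its distance is not constant. -/
theorem exists_eq [IsUltrametricDist K] [IsAlgClosed K] {a z y : K} {R : ℝ}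
    (h : IsRatOn {c | ‖c - a‖ ≤ R} φ)
    (hz : ‖z - a‖ ≤ R) (hne : ‖φ z - y‖ ≠ ‖φ a - y‖) : ∃ c, ‖c - a‖ ≤ R ∧ φ c = y := by
  obtain ⟨A, B, hAB⟩ := h
  by_contra! hno
  have ha : ‖a - a‖ ≤ R := by
    rw [sub_self, norm_zero]
    exact (norm_nonneg _).trans hz
  have key : ∀ c, ‖c - a‖ ≤ R →
      φ c - y = (A - Polynomial.C y * B).eval c / B.eval c := by
    intro c hc
    rw [(hAB c hc).2, Polynomial.eval_sub, Polynomial.eval_mul, Polynomial.eval_C, sub_div,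
      mul_div_cancel_right₀ _ (hAB c hc).1]
  apply hne
  rw [key z hz, key a ha, norm_div, norm_div,
    norm_eval_eq_of_forall_ne_zero _ (fun w hw => (hAB w hw).1) hz,
    norm_eval_eq_of_forall_ne_zero (A - Polynomial.C y * B) (a := a) (R := R) _ hz]
  intro w hw h0
  apply hno w hw
  rw [← sub_eq_zero, key w hw, h0, zero_div]

end IsRatOn

end Ultra
end

/-! ### Metric behaviour of P_λ and of its small perturbations on the unit ball. -/

noncomputable section

open Ultra

/-- The metric properties of `z ↦ a z ^ p + (1 - a) z ^ (p + 1)`, `‖a‖ = p`, on the unit ball that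
survive a small perturbation. -/
structure TameMap (p : ℕ) {K : Type*} [NormedField K] (g : K → K) : Prop where
  expand : ∀ z w, ‖z - 1‖ < 1 → ‖w - 1‖ < 1 → ‖g z - g w‖ = p * ‖z - w‖
  lip : ∀ z w, ‖z‖ ≤ 1 → ‖w‖ ≤ 1 → ‖g z - g w‖ ≤ p * ‖z - w‖
  norm_le : ∀ z, ‖z‖ < 1 → ‖g z‖ ≤ max (p * ‖z‖ ^ p) ((p : ℝ)⁻¹ ^ 2)
  norm_eq : ∀ z, ‖z‖ < 1 → (p : ℝ)⁻¹ ^ 2 < p * ‖z‖ ^ p → ‖g z‖ = p * ‖z‖ ^ p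
  contract : ∀ z w, (p : ℝ)⁻¹ ≤ ‖z‖ → ‖z‖ ≤ 1 → (p : ℝ)⁻¹ ≤ p * ‖z‖ ^ p →
    ‖w - z‖ ≤ (p : ℝ)⁻¹ ^ 2 → ‖g w - g z‖ ≤ p * ‖z‖ ^ p * ‖w - z‖

/-- `G` is bounded by `η` and `η`-Lipschitz on the unit ball. -/
structure SmallOnBall {K : Type*} [NormedField K] (η : ℝ) (G : K → K) : Prop where
  norm_le : ∀ z, ‖z‖ ≤ 1 → ‖G z‖ ≤ η
  lip : ∀ z w, ‖z‖ ≤ 1 → ‖w‖ ≤ 1 → ‖G z - G w‖ ≤ η * ‖z - w‖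

section

variable {K : Type*} [NormedField K] [IsUltrametricDist K]

theorem SmallOnBall.add {η : ℝ} {G H : K → K} (hG : SmallOnBall η G) (hH : SmallOnBall η H) :
    SmallOnBall η fun z => G z + H z where
  norm_le z hz := Ultra.norm_add_le_of_le (hG.norm_le z hz) (hH.norm_le z hz)
  lip z w hz hw := by
    rw [add_sub_add_comm]
    exact Ultra.norm_add_le_of_le (hG.lip z w hz hw) (hH.lip z w hz hw)

theorem norm_pow_sub_pow_le {x y : K} {t : ℝ} (hx : ‖x‖ ≤ t) (hy : ‖y‖ ≤ t) (n : ℕ) :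
    ‖x ^ (n + 1) - y ^ (n + 1)‖ ≤ ‖x - y‖ * t ^ n := by
  have ht : 0 ≤ t := (norm_nonneg _).trans hx
  induction n with
  | zero => simp
  | succ n ih =>
    have : x ^ (n + 1 + 1) - y ^ (n + 1 + 1)
        = x ^ (n + 1) * (x - y) + (x ^ (n + 1) - y ^ (n + 1)) * y := by ring
    rw [this]
    refine Ultra.norm_add_le_of_le ?_ ?_
    · rw [norm_mul, norm_pow, mul_comm]
      gcongr
    · rw [norm_mul, pow_succ t, ← mul_assoc]
      gcongr

/-- The middle binomial coefficients are divisible by p, so all terms of the expansion except d^p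
gain a factor p⁻¹. -/
theorem norm_add_pow_prime_sub_le {p : ℕ} (hp : p.Prime) (hpK : ‖(p : K)‖ = (p : ℝ)⁻¹)
    {z d : K} (hd : ‖d‖ ≤ ‖z‖) :
    ‖(z + d) ^ p - z ^ p‖ ≤ max (‖d‖ ^ p) ((p : ℝ)⁻¹ * ‖z‖ ^ (p - 1) * ‖d‖) := by
  rw [add_pow_prime_eq hp, show ∀ A B C : K, A + B + C - A = B + C by intros; ring]
  refine (IsUltrametricDist.norm_add_le_max _ _).trans (max_le_max (norm_pow _ _).le ?_)
  rw [norm_mul, norm_mul, norm_mul, hpK, mul_assoc, mul_assoc, mul_assoc, mul_comm ‖d‖,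
    show p - 1 = (p - 2) + 1 by have := hp.two_le; omega, pow_succ, mul_comm (‖z‖ ^ (p - 2)),
    mul_assoc]
  gcongr
  refine IsUltrametricDist.norm_sum_le_of_forall_le_of_nonneg (by positivity) fun k hk => ?_
  rw [norm_mul, norm_mul, norm_pow, norm_pow]
  have h1 : ‖((p.choose k / p : ℕ) : K)‖ ≤ 1 := IsUltrametricDist.norm_natCast_le_one K _
  rw [Finset.mem_Ioo] at hk
  calc ‖z‖ ^ (k - 1) * ‖d‖ ^ (p - k - 1) * ‖((p.choose k / p : ℕ) : K)‖
      ≤ ‖z‖ ^ (k - 1) * ‖z‖ ^ (p - k - 1) * 1 := by gcongr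
    _ = ‖z‖ ^ (p - 2) := by
      rw [mul_one, ← pow_add]
      congr 1
      omega

variable {p : ℕ} {a : K}

theorem norm_benedetto_sub_le (ha : ‖a‖ = p) (hp : p.Prime) {z w : K} (hz : ‖z‖ ≤ 1)
    (hw : ‖w‖ ≤ 1) :
    ‖(a * z ^ p + (1 - a) * z ^ (p + 1)) - (a * w ^ p + (1 - a) * w ^ (p + 1))‖
      ≤ p * ‖z - w‖ := by
  have hp1 : (1 : ℝ) ≤ p := by exact_mod_cast hp.one_le
  have h1a : ‖1 - a‖ ≤ p := Ultra.norm_sub_le_of_le (by simpa using hp1) ha.le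
  have e1 := norm_pow_sub_pow_le hz hw (p - 1)
  rw [Nat.sub_add_cancel hp.one_le, one_pow, mul_one] at e1
  have e2 := norm_pow_sub_pow_le hz hw p
  rw [one_pow, mul_one] at e2
  rw [add_sub_add_comm, ← mul_sub, ← mul_sub]
  refine Ultra.norm_add_le_of_le ?_ ?_
  · rw [norm_mul, ha]
    gcongr
  · rw [norm_mul]
    gcongr

theorem norm_benedetto_sub_eq (ha : ‖a‖ = p) (hp : p.Prime) {z w : K} (hz : ‖z - 1‖ < 1)
    (hw : ‖w - 1‖ < 1) :
    ‖(a * z ^ p + (1 - a) * z ^ (p + 1)) - (a * w ^ p + (1 - a) * w ^ (p + 1))‖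
      = p * ‖z - w‖ := by
  have hp1 : (1 : ℝ) < p := by exact_mod_cast hp.one_lt
  have one_of : ∀ x : K, ‖x - 1‖ < 1 → ‖x‖ = 1 := by
    intro x hx
    have := norm_eq_of_norm_sub_lt (x := (1 : K)) (y := x) (by rwa [norm_sub_rev, norm_one])
    rwa [norm_one] at this
  have hz1 := one_of z hz
  have hw1 := one_of w hw
  rcases eq_or_ne z w with rfl | hne
  · simp
  have hpos : 0 < ‖z - w‖ := norm_pos_iff.2 (sub_ne_zero.2 hne)
  have e1 := norm_pow_sub_pow_le hz1.le hw1.le (p - 1)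
  rw [Nat.sub_add_cancel hp.one_le, one_pow, mul_one] at e1
  have e2 := norm_pow_sub_pow_le hz1.le hw1.le p
  rw [one_pow, mul_one] at e2
  -- The map is z^(p+1) - a z^p (z - 1): near 1 the second term dominates, and in it the variation
  -- of z - 1 dominates that of z^p.
  have split : (a * z ^ p + (1 - a) * z ^ (p + 1)) - (a * w ^ p + (1 - a) * w ^ (p + 1))
      = -a * (z ^ p * (z - w) + (z ^ p - w ^ p) * (w - 1)) + (z ^ (p + 1) - w ^ (p + 1)) := by
    ring
  have main : ‖-a * (z ^ p * (z - w) + (z ^ p - w ^ p) * (w - 1))‖ = p * ‖z - w‖ := by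
    rw [norm_mul, norm_neg, ha, norm_add_eq_left_of_lt, norm_mul, norm_pow, hz1, one_pow, one_mul]
    rw [norm_mul, norm_mul, norm_pow, hz1, one_pow, one_mul]
    calc ‖z ^ p - w ^ p‖ * ‖w - 1‖ ≤ ‖z - w‖ * ‖w - 1‖ := by gcongr
      _ < ‖z - w‖ * 1 := by gcongr
      _ = ‖z - w‖ := mul_one _
  rw [split, norm_add_eq_left_of_lt, main]
  rw [main]
  nlinarith

theorem norm_benedetto_eq (ha : ‖a‖ = p) (hp : p.Prime) {z : K} (hz : ‖z‖ < 1) :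
    ‖a * z ^ p + (1 - a) * z ^ (p + 1)‖ = p * ‖z‖ ^ p := by
  have hp1 : (1 : ℝ) ≤ p := by exact_mod_cast hp.one_le
  have h1a : ‖1 - a‖ ≤ p := Ultra.norm_sub_le_of_le (by simpa using hp1) ha.le
  rcases eq_or_ne z 0 with rfl | h0
  · simp [hp.ne_zero]
  have hz0 : 0 < ‖z‖ := norm_pos_iff.2 h0
  have main : ‖a * z ^ p‖ = p * ‖z‖ ^ p := by rw [norm_mul, norm_pow, ha]
  rw [norm_add_eq_left_of_lt, main]
  rw [main, norm_mul, norm_pow]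
  calc ‖1 - a‖ * ‖z‖ ^ (p + 1) ≤ p * ‖z‖ ^ (p + 1) := by gcongr
    _ = p * ‖z‖ ^ p * ‖z‖ := by ring
    _ < p * ‖z‖ ^ p * 1 := by gcongr
    _ = _ := mul_one _

/-- Since |a p| = 1, the derivatives of the two terms have size at most |z|^(p-1) and p|z|^p; the
second bound is the larger once |z| ≥ p⁻¹. The remaining term a(w - z)^p is controlled by |w - z| ≤
p⁻² and p|z|^p ≥ p⁻¹. -/
theorem norm_benedetto_sub_le_of_close (ha : ‖a‖ = p) (hp : p.Prime)
    (hpK : ‖(p : K)‖ = (p : ℝ)⁻¹) {z w : K} (hz : (p : ℝ)⁻¹ ≤ ‖z‖)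
    (hz' : (p : ℝ)⁻¹ ≤ p * ‖z‖ ^ p) (hw : ‖w - z‖ ≤ (p : ℝ)⁻¹ ^ 2) :
    ‖(a * w ^ p + (1 - a) * w ^ (p + 1)) - (a * z ^ p + (1 - a) * z ^ (p + 1))‖
      ≤ p * ‖z‖ ^ p * ‖w - z‖ := by
  have hp1 : (1 : ℝ) ≤ p := by exact_mod_cast hp.one_le
  have hp0 : (0 : ℝ) < p := by linarith
  have hi1 : (p : ℝ)⁻¹ ≤ 1 := inv_le_one_of_one_le₀ hp1
  have hi0 : 0 < (p : ℝ)⁻¹ := by positivity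
  have h1a : ‖1 - a‖ ≤ p := Ultra.norm_sub_le_of_le (by simpa using hp1) ha.le
  have hd1 : ‖w - z‖ ≤ (p : ℝ)⁻¹ := hw.trans (by nlinarith)
  have hd : ‖w - z‖ ≤ ‖z‖ := hd1.trans hz
  have hwz : ‖w‖ ≤ ‖z‖ := by
    have := Ultra.norm_add_le_of_le hd le_rfl
    rwa [sub_add_cancel] at this
  have e1 := norm_add_pow_prime_sub_le hp hpK hd
  rw [add_sub_cancel] at e1
  have e2 := norm_pow_sub_pow_le hwz le_rfl p
  rw [add_sub_add_comm, ← mul_sub, ← mul_sub]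
  refine Ultra.norm_add_le_of_le ?_ ?_
  · rw [norm_mul, ha]
    have hcases := le_max_iff.1 e1
    rcases hcases with h | h
    · obtain ⟨k, hk⟩ : ∃ k, p = k + 2 := ⟨p - 2, by have := hp.two_le; omega⟩
      have hpow : ‖w - z‖ ^ p ≤ (p : ℝ)⁻¹ ^ 2 * ‖w - z‖ := by
        rw [hk, pow_succ, ← hk]
        gcongr
        calc ‖w - z‖ ^ (k + 1) ≤ ‖w - z‖ := by
              rw [pow_succ]
              exact mul_le_of_le_one_left (norm_nonneg _)
                (pow_le_one₀ (norm_nonneg _) (hd1.trans hi1))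
          _ ≤ _ := hw
      calc (p : ℝ) * ‖w ^ p - z ^ p‖ ≤ p * ((p : ℝ)⁻¹ ^ 2 * ‖w - z‖) := by
            gcongr
            exact h.trans hpow
        _ = (p : ℝ)⁻¹ * ‖w - z‖ := by field_simp
        _ ≤ _ := by gcongr
    · have hz1 : ‖z‖ ^ p = ‖z‖ * ‖z‖ ^ (p - 1) := by
        rw [← pow_succ', Nat.sub_add_cancel hp.one_le]
      calc (p : ℝ) * ‖w ^ p - z ^ p‖ ≤ p * ((p : ℝ)⁻¹ * ‖z‖ ^ (p - 1) * ‖w - z‖) := by gcongr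
        _ ≤ p * (‖z‖ * ‖z‖ ^ (p - 1) * ‖w - z‖) := by gcongr
        _ = _ := by rw [hz1]; ring
  · rw [norm_mul]
    calc ‖1 - a‖ * ‖w ^ (p + 1) - z ^ (p + 1)‖ ≤ p * (‖w - z‖ * ‖z‖ ^ p) := by gcongr
      _ = _ := by ring

/-- A perturbation of size and Lipschitz constant p⁻² never exceeds the main term: it competes with
the factor p near 1, and with p|z|^p ≥ p⁻¹ in `contract`. -/
theorem TameMap.of_smallOnBall (ha : ‖a‖ = p) (hp : p.Prime) (hpK : ‖(p : K)‖ = (p : ℝ)⁻¹)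
    {G g : K → K} (hG : SmallOnBall ((p : ℝ)⁻¹ ^ 2) G)
    (hg : ∀ z, ‖z‖ ≤ 1 → g z = a * z ^ p + (1 - a) * z ^ (p + 1) + G z) : TameMap p g := by
  have hp1 : (1 : ℝ) < p := by exact_mod_cast hp.one_lt
  have hp0 : (0 : ℝ) < p := by linarith
  have hi1 : (p : ℝ)⁻¹ ≤ 1 := inv_le_one_of_one_le₀ hp1.le
  have hi0 : 0 < (p : ℝ)⁻¹ := by positivity
  have hη1 : (p : ℝ)⁻¹ ^ 2 ≤ 1 := pow_le_one₀ hi0.le hi1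
  have hη2 : (p : ℝ)⁻¹ ^ 2 ≤ (p : ℝ)⁻¹ := by nlinarith
  have le_one_of : ∀ x : K, ‖x - 1‖ < 1 → ‖x‖ ≤ 1 := by
    intro x hx
    have := Ultra.norm_add_le_of_le hx.le (norm_one (α := K)).le
    rwa [sub_add_cancel] at this
  refine ⟨fun z w hz hw => ?_, fun z w hz hw => ?_, fun z hz => ?_, fun z hz h => ?_,
    fun z w hz hz1 hz' hwz => ?_⟩
  · rcases eq_or_ne z w with rfl | hne
    · simp
    have hpos : 0 < ‖z - w‖ := norm_pos_iff.2 (sub_ne_zero.2 hne)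
    rw [hg z (le_one_of z hz), hg w (le_one_of w hw), add_sub_add_comm, norm_add_eq_left_of_lt,
      norm_benedetto_sub_eq ha hp hz hw]
    rw [norm_benedetto_sub_eq ha hp hz hw]
    refine (hG.lip z w (le_one_of z hz) (le_one_of w hw)).trans_lt ?_
    gcongr
    linarith
  · rw [hg z hz, hg w hw, add_sub_add_comm]
    refine Ultra.norm_add_le_of_le (norm_benedetto_sub_le ha hp hz hw) ((hG.lip z w hz hw).trans ?_)
    gcongr
    linarith
  · rw [hg z hz.le, ← norm_benedetto_eq ha hp hz]
    exact (IsUltrametricDist.norm_add_le_max _ _).trans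
      (max_le_max le_rfl (hG.norm_le z hz.le))
  · rw [hg z hz.le, norm_add_eq_left_of_lt, norm_benedetto_eq ha hp hz]
    rw [norm_benedetto_eq ha hp hz]
    exact (hG.norm_le z hz.le).trans_lt h
  · have hw1 : ‖w‖ ≤ 1 := by
      have := Ultra.norm_add_le_of_le (hwz.trans hη1) hz1
      rwa [sub_add_cancel] at this
    rw [hg z hz1, hg w hw1, add_sub_add_comm]
    refine Ultra.norm_add_le_of_le (norm_benedetto_sub_le_of_close ha hp hpK hz hz' hwz)
      ((hG.lip w z hw1 hz1).trans ?_)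
    gcongr
    exact hη2.trans hz'

end
end

/-! ### The circles of radius t_k and one-parameter families of tame maps. -/

noncomputable section

open Ultra

/-- The radii with `t 0 = 1` and `p * t (k + 1) ^ p = t k`: a point of norm `t k` in the unit ball
reaches norm `1` after `k` steps. -/
def returnRadius (p : ℕ) : ℕ → ℝ
  | 0 => 1
  | k + 1 => (returnRadius p k / p) ^ ((p : ℝ)⁻¹)

section Radius

variable {p : ℕ}

theorem returnRadius_zero : returnRadius p 0 = 1 := rfl

theorem returnRadius_pos (hp : p.Prime) (k : ℕ) : 0 < returnRadius p k := by
  have hp0 : (0 : ℝ) < p := by exact_mod_cast hp.pos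
  induction k with
  | zero => exact one_pos
  | succ k ih => exact Real.rpow_pos_of_pos (div_pos ih hp0) _

theorem mul_returnRadius_succ_pow (hp : p.Prime) (k : ℕ) :
    p * returnRadius p (k + 1) ^ p = returnRadius p k := by
  have hp0 : (0 : ℝ) < p := by exact_mod_cast hp.pos
  have := Real.rpow_inv_natCast_pow (div_pos (returnRadius_pos hp k) hp0).le hp.ne_zero
  rw [returnRadius, this, mul_div_cancel₀ _ hp0.ne']

theorem eq_returnRadius_succ (hp : p.Prime) {s : ℝ} (hs : 0 ≤ s) {k : ℕ}
    (h : p * s ^ p = returnRadius p k) : s = returnRadius p (k + 1) := by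
  have hp0 : (0 : ℝ) < p := by exact_mod_cast hp.pos
  rw [← mul_returnRadius_succ_pow hp] at h
  exact (pow_left_inj₀ hs (returnRadius_pos hp _).le hp.ne_zero).1 (mul_left_cancel₀ hp0.ne' h)

theorem lt_of_mul_pow_lt (hp : p.Prime) {s t : ℝ} (ht : 0 ≤ t) (h : p * s ^ p < p * t ^ p) :
    s < t := by
  have hp0 : (0 : ℝ) < p := by exact_mod_cast hp.pos
  exact lt_of_pow_lt_pow_left₀ p ht (lt_of_mul_lt_mul_left h hp0.le)

theorem mul_inv_pow_le_inv (hp : p.Prime) : (p : ℝ) * (p : ℝ)⁻¹ ^ p ≤ (p : ℝ)⁻¹ := by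
  have hp1 : (1 : ℝ) ≤ p := by exact_mod_cast hp.one_le
  have hp0 : (0 : ℝ) < p := by linarith
  calc (p : ℝ) * (p : ℝ)⁻¹ ^ p ≤ p * (p : ℝ)⁻¹ ^ 2 := by
        gcongr ?_ * ?_
        exact pow_le_pow_of_le_one (by positivity) (inv_le_one_of_one_le₀ hp1) hp.two_le
    _ = _ := by field_simp

theorem inv_lt_of_inv_lt_mul_pow (hp : p.Prime) {s : ℝ} (hs : 0 ≤ s)
    (h : (p : ℝ)⁻¹ < p * s ^ p) : (p : ℝ)⁻¹ < s :=
  lt_of_mul_pow_lt hp hs ((mul_inv_pow_le_inv hp).trans_lt h)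

/-- The recursion preserves the bound p⁻¹ because p(p⁻¹)^p ≤ p⁻¹. Hence perturbations of size p⁻² do
not affect norms on these circles, and `contract` applies there. -/
theorem inv_lt_returnRadius (hp : p.Prime) (k : ℕ) : (p : ℝ)⁻¹ < returnRadius p k := by
  induction k with
  | zero => exact inv_lt_one_of_one_lt₀ (by exact_mod_cast hp.one_lt)
  | succ k ih =>
    refine inv_lt_of_inv_lt_mul_pow hp (returnRadius_pos hp _).le ?_
    rwa [mul_returnRadius_succ_pow hp]

theorem returnRadius_succ_lt (hp : p.Prime) (k : ℕ) :
    returnRadius p (k + 1) < returnRadius p k := by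
  have hp1 : (1 : ℝ) < p := by exact_mod_cast hp.one_lt
  induction k with
  | zero =>
    refine lt_of_mul_pow_lt hp (returnRadius_pos hp _).le ?_
    rw [mul_returnRadius_succ_pow hp, returnRadius_zero]
    simpa using hp1
  | succ k ih =>
    refine lt_of_mul_pow_lt hp (returnRadius_pos hp _).le ?_
    rwa [mul_returnRadius_succ_pow hp, mul_returnRadius_succ_pow hp]

theorem returnRadius_antitone (hp : p.Prime) : Antitone (returnRadius p) :=
  antitone_nat_of_succ_le fun k => (returnRadius_succ_lt hp k).le

theorem returnRadius_le_one (hp : p.Prime) (k : ℕ) : returnRadius p k ≤ 1 :=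
  returnRadius_antitone hp (Nat.zero_le k)

theorem returnRadius_succ_lt_one (hp : p.Prime) (k : ℕ) : returnRadius p (k + 1) < 1 :=
  (returnRadius_succ_lt hp k).trans_le (returnRadius_le_one hp k)

theorem returnRadius_succ_le (hp : p.Prime) (k : ℕ) :
    returnRadius p (k + 1) ≤ returnRadius p 1 :=
  returnRadius_antitone hp (Nat.le_add_left 1 k)

/-- The radius `p⁻ᵐ / t 1` of a ball of parameters. -/
def parRadius (p m : ℕ) : ℝ := (p : ℝ)⁻¹ ^ m / returnRadius p 1

theorem parRadius_pos (hp : p.Prime) (m : ℕ) : 0 < parRadius p m := by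
  have hp0 : (0 : ℝ) < p := by exact_mod_cast hp.pos
  exact div_pos (by positivity) (returnRadius_pos hp 1)

/-- The normalisation of `parRadius`: a similarity of ratio t_1 followed by m expansions by p takes
the parameter ball to radius 1. -/
theorem pow_mul_parRadius (hp : p.Prime) (m : ℕ) :
    (p : ℝ) ^ m * (returnRadius p 1 * parRadius p m) = 1 := by
  have hp0 : (0 : ℝ) < p := by exact_mod_cast hp.pos
  have := returnRadius_pos hp 1
  unfold parRadius
  field_simp
  rw [← mul_pow, mul_one_div_cancel hp0.ne', one_pow]

theorem parRadius_add (m k : ℕ) : parRadius p (m + k) = (p : ℝ)⁻¹ ^ k * parRadius p m := by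
  unfold parRadius
  ring

theorem parRadius_add_lt (hp : p.Prime) (m : ℕ) {k : ℕ} (hk : k ≠ 0) :
    parRadius p (m + k) < parRadius p m := by
  rw [parRadius_add]
  have hp1 : (1 : ℝ) < p := by exact_mod_cast hp.one_lt
  exact mul_lt_of_lt_one_left (parRadius_pos hp m)
    (pow_lt_one₀ (by positivity) (inv_lt_one_of_one_lt₀ hp1) hk)

end Radius

variable {K : Type*} [NormedField K]

/-- A one-parameter family of tame maps whose members differ by multiples of `z (z - β)`, where
`β` is a common fixed point. -/
structure TameFamily (p : ℕ) (g : K → K → K) (β : K) : Prop where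
  prime : p.Prime
  norm_p : ‖(p : K)‖ = (p : ℝ)⁻¹
  tame : ∀ c, ‖c‖ ≤ (p : ℝ)⁻¹ ^ 2 → TameMap p (g c)
  sub : ∀ c c' z, ‖z‖ ≤ 1 → g c z - g c' z = (c - c') * (z * (z - β))
  fix : ∀ c, g c β = β
  near : ‖β - 1‖ < 1
  rat : ∀ (S : Set K) (φ ψ : K → K), IsRatOn S φ → IsRatOn S ψ → (∀ c ∈ S, ‖φ c‖ ≤ 1) →
    IsRatOn S fun c => g (ψ c) (φ c)

/-- The recursion of `returnRadius`, started strictly between 1 and p and realised by norms. A point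
of norm |v k| climbs to norm |v 0| > 1, so its distance to β is no longer 1; this is the
non-constancy needed by `IsRatOn.exists_eq`. -/
theorem exists_norm_pow_seq [IsAlgClosed K] {p : ℕ} (hp : p.Prime)
    (hpK : ‖(p : K)‖ = (p : ℝ)⁻¹) :
    ∃ v : ℕ → K, 1 < ‖v 0‖ ∧ ‖v 0‖ < p ∧ ∀ k, p * ‖v (k + 1)‖ ^ p = ‖v k‖ := by
  have hp1 : (1 : ℝ) < p := by exact_mod_cast hp.one_lt
  obtain ⟨v0, hv0⟩ := IsAlgClosed.exists_pow_nat_eq ((p : K)⁻¹) (n := 2) two_pos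
  choose r hr using fun x : K => IsAlgClosed.exists_pow_nat_eq ((p : K) * x) hp.pos
  have hn : ‖v0‖ ^ 2 = p := by rw [← norm_pow, hv0, norm_inv, hpK, inv_inv]
  refine ⟨fun k => Nat.rec v0 (fun _ x => r x) k, ?_, ?_, fun k => ?_⟩
  · change 1 < ‖v0‖
    nlinarith [norm_nonneg v0]
  · change ‖v0‖ < p
    nlinarith [norm_nonneg v0]
  · change p * ‖r _‖ ^ p = _
    rw [← norm_pow, hr, norm_mul, hpK, mul_inv_cancel_left₀ (by linarith)]

theorem norm_seq_succ_lt_one {p : ℕ} (hp : p.Prime) {v : ℕ → K}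
    (hv : ∀ k, p * ‖v (k + 1)‖ ^ p = ‖v k‖) (h0 : ‖v 0‖ < p) (k : ℕ) : ‖v (k + 1)‖ < 1 := by
  have hp1 : (1 : ℝ) ≤ p := by exact_mod_cast hp.one_le
  refine lt_of_mul_pow_lt hp zero_le_one ?_
  rw [hv, one_pow, mul_one]
  induction k with
  | zero => exact h0
  | succ k ih =>
    refine lt_of_lt_of_le (lt_of_mul_pow_lt hp zero_le_one ?_) hp1
    rwa [hv, one_pow, mul_one]

theorem inv_lt_norm_seq {p : ℕ} (hp : p.Prime) {v : ℕ → K}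
    (hv : ∀ k, p * ‖v (k + 1)‖ ^ p = ‖v k‖) (h1 : 1 < ‖v 0‖) (k : ℕ) : (p : ℝ)⁻¹ < ‖v k‖ := by
  have hp1 : (1 : ℝ) ≤ p := by exact_mod_cast hp.one_le
  induction k with
  | zero => exact (inv_le_one_of_one_le₀ hp1).trans_lt h1
  | succ k ih =>
    refine inv_lt_of_inv_lt_mul_pow hp (norm_nonneg _) ?_
    rwa [hv]

namespace TameFamily

variable {p : ℕ} {g : K → K → K} {β : K}

theorem one_lt (F : TameFamily p g β) : (1 : ℝ) < p := by exact_mod_cast F.prime.one_lt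

theorem p_inv_pos (F : TameFamily p g β) : 0 < (p : ℝ)⁻¹ :=
  inv_pos.2 (one_pos.trans F.one_lt)

theorem p_inv_lt_one (F : TameFamily p g β) : (p : ℝ)⁻¹ < 1 := inv_lt_one_of_one_lt₀ F.one_lt

theorem inv_sq_lt_inv (F : TameFamily p g β) : (p : ℝ)⁻¹ ^ 2 < (p : ℝ)⁻¹ := by
  have h0 := F.p_inv_pos
  have h1 := F.p_inv_lt_one
  nlinarith

theorem norm_map_sub_le_of_circle (F : TameFamily p g β) {c z w : K} {k : ℕ}
    (hc : ‖c‖ ≤ (p : ℝ)⁻¹ ^ 2) (hw : ‖w‖ = returnRadius p (k + 1))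
    (hzw : ‖z - w‖ ≤ (p : ℝ)⁻¹ ^ 2) : ‖g c z - g c w‖ ≤ returnRadius p k * ‖z - w‖ := by
  have := (F.tame c hc).contract w z (hw ▸ (inv_lt_returnRadius F.prime _).le)
    (hw ▸ returnRadius_le_one F.prime _)
    (by rw [hw, mul_returnRadius_succ_pow F.prime]; exact (inv_lt_returnRadius F.prime _).le) hzw
  rwa [hw, mul_returnRadius_succ_pow F.prime] at this

theorem norm_map_le_of_le (F : TameFamily p g β) {c z : K} {R : ℝ} (hc : ‖c‖ ≤ (p : ℝ)⁻¹ ^ 2)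
    (hz : ‖z‖ < 1) (hzR : ‖z‖ ≤ R) (hR : (p : ℝ)⁻¹ < p * R ^ p) : ‖g c z‖ ≤ p * R ^ p := by
  have hp1 := F.one_lt
  refine ((F.tame c hc).norm_le z hz).trans (max_le (by gcongr) ?_)
  exact F.inv_sq_lt_inv.le.trans hR.le

/-- An orbit entering this small ball is trapped near 0; it serves as the reference orbit that never
climbs. -/
theorem norm_map_le_inv_sq (F : TameFamily p g β) {c z : K} (hc : ‖c‖ ≤ (p : ℝ)⁻¹ ^ 2)
    (hz : ‖z‖ ≤ (p : ℝ)⁻¹ ^ 2) : ‖g c z‖ ≤ (p : ℝ)⁻¹ ^ 2 := by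
  have h0 := F.p_inv_pos
  have h1 := F.p_inv_lt_one
  have hp1 := F.one_lt
  have hlt := F.inv_sq_lt_inv
  refine ((F.tame c hc).norm_le z (by linarith)).trans (max_le ?_ le_rfl)
  calc (p : ℝ) * ‖z‖ ^ p ≤ p * ((p : ℝ)⁻¹ ^ 2) ^ 2 := by
        gcongr ?_ * ?_
        calc ‖z‖ ^ p ≤ ‖z‖ ^ 2 :=
              pow_le_pow_of_le_one (norm_nonneg _) (by linarith) F.prime.two_le
          _ ≤ _ := by gcongr
    _ = (p : ℝ)⁻¹ ^ 2 * (p : ℝ)⁻¹ := by field_simp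
    _ ≤ _ := mul_le_of_le_one_right (by positivity) h1.le

theorem norm_eq_returnRadius_succ (F : TameFamily p g β) {c z : K} {k : ℕ}
    (hc : ‖c‖ ≤ (p : ℝ)⁻¹ ^ 2) (hz : ‖z‖ < 1) (h : ‖g c z‖ = returnRadius p k) :
    ‖z‖ = returnRadius p (k + 1) := by
  have hlt : (p : ℝ)⁻¹ ^ 2 < ‖g c z‖ := by
    rw [h]
    exact F.inv_sq_lt_inv.trans (inv_lt_returnRadius F.prime k)
  have hlt' : (p : ℝ)⁻¹ ^ 2 < p * ‖z‖ ^ p := by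
    rcases lt_max_iff.1 (hlt.trans_le ((F.tame c hc).norm_le z hz)) with h | h
    · exact h
    · exact absurd h (lt_irrefl _)
  refine eq_returnRadius_succ F.prime (norm_nonneg z) ?_
  rw [← h, (F.tame c hc).norm_eq z hz hlt']

/-- Rationality in the parameter makes `IsRatOn.exists_eq` available for orbit points; the bound at
times before n keeps the orbit away from poles. -/
theorem isRatOn_iterate (F : TameFamily p g β) (S : Set K) (x₀ : K) (n : ℕ)
    (h : ∀ c ∈ S, ∀ k < n, ‖(g c)^[k] x₀‖ ≤ 1) : IsRatOn S fun c => (g c)^[n] x₀ := by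
  induction n with
  | zero => simpa using IsRatOn.polynomial S (Polynomial.C x₀)
  | succ n ih =>
    simp only [Function.iterate_succ_apply']
    exact F.rat S _ _ (ih fun c hc k hk => h c hc k (hk.trans n.lt_succ_self)) (IsRatOn.id S)
      fun c hc => h c hc n n.lt_succ_self

variable [IsUltrametricDist K]

theorem norm_fix (F : TameFamily p g β) : ‖β‖ = 1 := by
  have := norm_eq_of_norm_sub_lt (x := (1 : K)) (y := β)
    (by rw [norm_sub_rev, norm_one]; exact F.near)
  rwa [norm_one] at this

theorem norm_eq_one_of_near (F : TameFamily p g β) {z : K} (hz : ‖z - β‖ < 1) : ‖z‖ = 1 := by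
  rw [← F.norm_fix]
  exact norm_eq_of_norm_sub_lt (by rwa [norm_sub_rev, F.norm_fix])

theorem norm_sub_one_lt (F : TameFamily p g β) {z : K} (hz : ‖z - β‖ < 1) : ‖z - 1‖ < 1 := by
  rw [← sub_add_sub_cancel z β 1]
  exact norm_add_lt_of_lt hz F.near

theorem norm_sub_fix (F : TameFamily p g β) {z : K} (hz : ‖z‖ < 1) : ‖z - β‖ = 1 := by
  rw [norm_sub_rev, sub_eq_add_neg, norm_add_eq_left_of_lt, F.norm_fix]
  rwa [norm_neg, F.norm_fix]

/-- The distance of the points is multiplied by p, while changing the parameter moves the image by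
at most |c - c'|, as |w(w - β)| < 1. -/
theorem norm_sub_eq_of_near (F : TameFamily p g β) {c c' z w : K} (hc : ‖c‖ ≤ (p : ℝ)⁻¹ ^ 2)
    (hz : ‖z - β‖ < 1) (hw : ‖w - β‖ < 1) (h : c ≠ c' → ‖c - c'‖ < p * ‖z - w‖) :
    ‖g c z - g c' w‖ = p * ‖z - w‖ := by
  have hw1 := F.norm_eq_one_of_near hw
  have hexp := (F.tame c hc).expand z w (F.norm_sub_one_lt hz) (F.norm_sub_one_lt hw)
  rcases eq_or_ne c c' with rfl | hne
  · exact hexp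
  rw [← sub_add_sub_cancel _ (g c w), F.sub c c' w hw1.le, norm_add_eq_left_of_lt, hexp]
  rw [hexp, norm_mul, norm_mul, hw1, one_mul]
  exact (mul_le_of_le_one_right (norm_nonneg _) hw.le).trans_lt (h hne)

/-- Inside the open unit ball |w - β| = 1. The factor w in the perturbation makes the effect of the
parameter strictly larger on larger circles, so that the last step of a climb will dominate. -/
theorem norm_par_sub_of_circle (F : TameFamily p g β) {c c' w : K} {k : ℕ}
    (hw : ‖w‖ = returnRadius p (k + 1)) :
    ‖g c w - g c' w‖ = returnRadius p (k + 1) * ‖c - c'‖ := by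
  have h1 : ‖w‖ < 1 := hw ▸ returnRadius_succ_lt_one F.prime k
  rw [F.sub c c' w h1.le, norm_mul, norm_mul, F.norm_sub_fix h1, mul_one, hw, mul_comm]

end TameFamily
end

/-! ### Stages: expansion along the stay near β, and landing on β again. -/

noncomputable section

open Ultra

variable {K : Type*} [NormedField K]

/-- At the parameter `c` the orbit of `x₀` hits the repelling fixed point `β` at time `N`; for the
parameters in the ball of radius `parRadius p m` about `c` the point at time `N` depends on the
parameter like a similarity, and the images of the disc of radius `s` about `x₀` remain small. -/
structure Stage (p : ℕ) (g : K → K → K) (β x₀ : K) (s : ℝ) (c : K) (N m : ℕ) : Prop where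
  norm_le : ‖c‖ ≤ (p : ℝ)⁻¹ ^ 2
  parRadius_le : parRadius p m ≤ (p : ℝ)⁻¹ ^ 2
  hit : (g c)^[N] x₀ = β
  similar : ∀ c' c'', ‖c' - c‖ ≤ parRadius p m → ‖c'' - c‖ ≤ parRadius p m →
    ‖(g c')^[N] x₀ - (g c'')^[N] x₀‖ = returnRadius p 1 * ‖c' - c''‖
  bounded : ∀ c', ‖c' - c‖ ≤ parRadius p m → ∀ k ≤ N, ‖(g c')^[k] x₀‖ ≤ 1
  close : ∀ c', ‖c' - c‖ ≤ parRadius p m → ∀ x, ‖x - x₀‖ ≤ s → ∀ k ≤ N,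
    ‖(g c')^[k] x - (g c')^[k] x₀‖ ≤ (p : ℝ)⁻¹ ^ 2
  close_end : ∀ c', ‖c' - c‖ ≤ parRadius p m → ∀ x, ‖x - x₀‖ ≤ s →
    ‖(g c')^[N] x - (g c')^[N] x₀‖ ≤ (p : ℝ)⁻¹ ^ 2 * (p : ℝ)⁻¹ ^ (m + 1)

namespace Stage

variable {p : ℕ} {g : K → K → K} {β x₀ c : K} {s : ℝ} {N m : ℕ}

theorem iterate_eq_fix (F : TameFamily p g β) (S : Stage p g β x₀ s c N m) (k : ℕ) :
    (g c)^[N + k] x₀ = β := by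
  rw [add_comm, Function.iterate_add_apply, S.hit]
  exact Function.iterate_fixed (F.fix c) k

theorem pow_mul_lt_one (F : TameFamily p g β) {k : ℕ} (hk : k ≤ m) {d : ℝ}
    (hd : d < parRadius p m) (hd0 : 0 ≤ d) : (p : ℝ) ^ k * (returnRadius p 1 * d) < 1 := by
  have hp1 := F.one_lt
  have hC := returnRadius_pos F.prime 1
  rw [← pow_mul_parRadius F.prime m]
  calc (p : ℝ) ^ k * (returnRadius p 1 * d) ≤ (p : ℝ) ^ m * (returnRadius p 1 * d) := by
        gcongr
        exact hp1.le
    _ < _ := by gcongr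

variable [IsUltrametricDist K]

theorem norm_par_le (S : Stage p g β x₀ s c N m) {c' : K} (h : ‖c' - c‖ ≤ parRadius p m) :
    ‖c'‖ ≤ (p : ℝ)⁻¹ ^ 2 := by
  rw [← sub_add_cancel c' c]
  exact Ultra.norm_add_le_of_le (h.trans S.parRadius_le) S.norm_le

/-- Each step near β multiplies by p, and p t_1 > 1 makes this dominate the direct effect of the
parameter from the first step on. The range extends to m + 1 because a step needs only the previous
point to be near β. -/
theorem norm_sub_eq (F : TameFamily p g β) (S : Stage p g β x₀ s c N m) {k : ℕ}
    (hk : k ≤ m + 1) {c' c'' : K} (h' : ‖c' - c‖ < parRadius p m)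
    (h'' : ‖c'' - c‖ < parRadius p m) :
    ‖(g c')^[N + k] x₀ - (g c'')^[N + k] x₀‖ = p ^ k * (returnRadius p 1 * ‖c' - c''‖) := by
  have hp1 := F.one_lt
  have hC := returnRadius_pos F.prime 1
  have hpC : 1 < p * returnRadius p 1 := by
    have := mul_lt_mul_of_pos_left (inv_lt_returnRadius F.prime 1) (one_pos.trans hp1)
    rwa [mul_inv_cancel₀ (by linarith)] at this
  induction k generalizing c' c'' with
  | zero => simpa using S.similar c' c'' h'.le h''.le
  | succ k ih =>
    have near : ∀ b, ‖b - c‖ < parRadius p m → ‖(g b)^[N + k] x₀ - β‖ < 1 := by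
      intro b hb
      rw [← S.iterate_eq_fix F k, ih (by omega) hb (by simpa using parRadius_pos F.prime m)]
      exact pow_mul_lt_one F (by omega) hb (norm_nonneg _)
    rw [← add_assoc, Function.iterate_succ_apply', Function.iterate_succ_apply',
      F.norm_sub_eq_of_near (S.norm_par_le h'.le) (near c' h') (near c'' h''),
      ih (by omega) h' h'', pow_succ']
    · ring
    · intro hne
      have hd : 0 < ‖c' - c''‖ := norm_pos_iff.2 (sub_ne_zero.2 hne)
      rw [ih (by omega) h' h'']
      have h1 : (1 : ℝ) ≤ p ^ k := one_le_pow₀ hp1.le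
      calc ‖c' - c''‖ = 1 * (1 * ‖c' - c''‖) := by ring
        _ < (p : ℝ) ^ k * (p * returnRadius p 1 * ‖c' - c''‖) := by
          refine mul_lt_mul' h1 ?_ (by positivity) (by positivity)
          gcongr
        _ = _ := by ring

theorem norm_sub_fix_lt_one (F : TameFamily p g β) (S : Stage p g β x₀ s c N m) {k : ℕ}
    (hk : k ≤ m) {c' : K} (h' : ‖c' - c‖ < parRadius p m) :
    ‖(g c')^[N + k] x₀ - β‖ < 1 := by
  rw [← S.iterate_eq_fix F k,
    S.norm_sub_eq F (by omega) h' (by simpa using parRadius_pos F.prime m)]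
  exact pow_mul_lt_one F hk h' (norm_nonneg _)

theorem norm_le_one (F : TameFamily p g β) (S : Stage p g β x₀ s c N m) {k : ℕ}
    (hk : k ≤ N + m) {c' : K} (h' : ‖c' - c‖ < parRadius p m) : ‖(g c')^[k] x₀‖ ≤ 1 := by
  rcases le_total k N with h | h
  · exact S.bounded c' h'.le k h
  · obtain ⟨j, rfl⟩ := Nat.exists_eq_add_of_le h
    exact (F.norm_eq_one_of_near (S.norm_sub_fix_lt_one F (by omega) h')).le

/-- The m + 1 expansions consume exactly the reserve p⁻¹ ^ (m + 1) of `close_end`. -/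
theorem close_of_le (F : TameFamily p g β) (S : Stage p g β x₀ s c N m) {k : ℕ}
    (hk : k ≤ m + 1) {c' x : K} (h' : ‖c' - c‖ < parRadius p m) (hx : ‖x - x₀‖ ≤ s) :
    ‖(g c')^[N + k] x - (g c')^[N + k] x₀‖
      ≤ p ^ k * ((p : ℝ)⁻¹ ^ 2 * (p : ℝ)⁻¹ ^ (m + 1)) := by
  have hp1 := F.one_lt
  have hp0 : (0 : ℝ) < p := by linarith
  induction k with
  | zero => simpa using S.close_end c' h'.le x hx
  | succ k ih =>
    have near := S.norm_sub_fix_lt_one F (k := k) (by omega) h'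
    have ih := ih (by omega)
    have hlt : (p : ℝ) ^ k * ((p : ℝ)⁻¹ ^ 2 * (p : ℝ)⁻¹ ^ (m + 1)) < 1 := by
      calc (p : ℝ) ^ k * ((p : ℝ)⁻¹ ^ 2 * (p : ℝ)⁻¹ ^ (m + 1))
          ≤ (p : ℝ) ^ (m + 1) * ((p : ℝ)⁻¹ ^ 2 * (p : ℝ)⁻¹ ^ (m + 1)) := by
            gcongr
            · exact hp1.le
            · omega
        _ = (p : ℝ)⁻¹ ^ 2 := by
          rw [inv_pow _ (m + 1)]
          field_simp
        _ < 1 := F.inv_sq_lt_inv.trans F.p_inv_lt_one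
    have near' : ‖(g c')^[N + k] x - β‖ < 1 := by
      rw [← sub_add_sub_cancel _ ((g c')^[N + k] x₀)]
      exact norm_add_lt_of_lt (ih.trans_lt hlt) near
    rw [← add_assoc, Function.iterate_succ_apply', Function.iterate_succ_apply',
      F.norm_sub_eq_of_near (S.norm_par_le h'.le) near' near fun h => absurd rfl h, pow_succ',
      mul_assoc]
    gcongr

/-- After m + 1 expansions the orbit point sweeps a disc of radius p about β as the parameter
varies, so it reaches 0. Near a parameter sending it to 0, another one sends it close to 0 but at
the height from which M steps lead to β. -/
theorem exists_landing [IsAlgClosed K] (F : TameFamily p g β)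
    (S : Stage p g β x₀ s c N m) {M : ℕ} (hM : 1 ≤ M) :
    ∃ b, ‖b - c‖ < parRadius p m ∧ (g b)^[N + (m + 1) + M] x₀ = β ∧
      ∀ j ≤ M, ‖(g b)^[N + (m + 1) + j] x₀‖ = returnRadius p (M - j) := by
  have hp1 := F.one_lt
  have hp0 : (0 : ℝ) < p := by linarith
  have hδ := parRadius_pos F.prime m
  obtain ⟨v, hv0, hv0', hv⟩ := exists_norm_pow_seq F.prime F.norm_p
  obtain ⟨u, hu⟩ : ∃ u : K, ‖u‖ = returnRadius p 1 := by
    obtain ⟨u, hu⟩ := IsAlgClosed.exists_pow_nat_eq (p : K) F.prime.pos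
    refine ⟨u, eq_returnRadius_succ F.prime (norm_nonneg u) ?_⟩
    rw [← norm_pow, hu, F.norm_p, returnRadius_zero, mul_inv_cancel₀ hp0.ne']
  have hC := returnRadius_pos F.prime 1
  -- The ratio of the similarity from parameters to orbit points at time N + (m + 1).
  set κ : ℝ := p ^ (m + 1) * returnRadius p 1 with hκ
  have hκ0 : 0 < κ := by positivity
  have hκδ : κ * parRadius p m = p := by
    have := pow_mul_parRadius F.prime m
    rw [hκ, pow_succ]
    linear_combination (p : ℝ) * this
  have scale : ∀ x : K, ∃ y : K, ‖y‖ = ‖x‖ / κ := fun x =>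
    ⟨x * p ^ (m + 1) / u, by
      rw [norm_div, norm_mul, norm_pow, F.norm_p, hu, hκ, inv_pow]
      field_simp⟩
  have lt_of : ∀ d : ℝ, κ * d < p → d < parRadius p m := by
    intro d hd
    rw [← hκδ] at hd
    exact lt_of_mul_lt_mul_left hd hκ0.le
  have hsub : ∀ c' c'', ‖c' - c‖ < parRadius p m → ‖c'' - c‖ < parRadius p m →
      ‖(g c')^[N + (m + 1)] x₀ - (g c'')^[N + (m + 1)] x₀‖ = κ * ‖c' - c''‖ := by
    intro c' c'' h' h''
    rw [S.norm_sub_eq F le_rfl h' h'', ← mul_assoc]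
  have hcc : ‖c - c‖ < parRadius p m := by simpa using hδ
  -- a parameter for which the orbit passes through `0`
  obtain ⟨d₀, hd₀⟩ := scale (v 0)
  have hd₀κ : κ * ‖d₀‖ = ‖v 0‖ := by rw [hd₀]; field_simp
  have hd₀lt : ‖d₀‖ < parRadius p m := lt_of _ (hd₀κ ▸ hv0')
  obtain ⟨a, ha, ha0⟩ : ∃ a, ‖a - c‖ ≤ ‖d₀‖ ∧ (g a)^[N + (m + 1)] x₀ = 0 := by
    refine (F.isRatOn_iterate {c' | ‖c' - c‖ ≤ ‖d₀‖} x₀ (N + (m + 1)) fun c' hc' k hk =>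
      S.norm_le_one F (by omega) (lt_of_le_of_lt hc' hd₀lt)).exists_eq
      (z := c + d₀) (by simp) ?_
    rw [sub_zero, sub_zero, S.iterate_eq_fix F, F.norm_fix]
    intro h1
    have := hsub (c + d₀) c (by simpa using hd₀lt) hcc
    rw [S.iterate_eq_fix F, add_sub_cancel_left, hd₀κ] at this
    have h2 := Ultra.norm_sub_le_of_le h1.le F.norm_fix.le
    linarith
  have haδ := ha.trans_lt hd₀lt
  -- a parameter near `a` for which the orbit returns to `β`
  obtain ⟨d, hd⟩ := scale (v M)
  have hdκ : κ * ‖d‖ = ‖v M‖ := by rw [hd]; field_simp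
  have v_lt : ∀ j < M, ‖v (M - j)‖ < 1 := by
    intro j hj
    obtain ⟨k, hk⟩ : ∃ k, M - j = k + 1 := ⟨M - j - 1, by omega⟩
    rw [hk]
    exact norm_seq_succ_lt_one F.prime hv hv0' k
  have hball : ∀ b, ‖b - a‖ ≤ ‖d‖ → ‖b - c‖ < parRadius p m := by
    intro b hb
    rw [← sub_add_sub_cancel b a c]
    refine norm_add_lt_of_lt (hb.trans_lt (lt_of _ ?_)) haδ
    rw [hdκ]
    have := v_lt 0 (by omega)
    rw [Nat.sub_zero] at this
    linarith
  have hle : ∀ b, ‖b - a‖ ≤ ‖d‖ → ∀ j ≤ M, ‖(g b)^[N + (m + 1) + j] x₀‖ ≤ ‖v (M - j)‖ := by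
    intro b hb j
    induction j with
    | zero =>
      intro _
      have := hsub b a (hball b hb) haδ
      rw [ha0, sub_zero] at this
      rw [add_zero, this, Nat.sub_zero, ← hdκ]
      gcongr
    | succ j ih =>
      intro hj
      have ih := ih (by omega)
      have hvj := hv (M - (j + 1))
      rw [show M - (j + 1) + 1 = M - j by omega] at hvj
      rw [← add_assoc, Function.iterate_succ_apply', ← hvj]
      refine F.norm_map_le_of_le (S.norm_par_le (hball b hb).le) (ih.trans_lt (v_lt j (by omega)))
        ih ?_
      rw [hvj]
      exact inv_lt_norm_seq F.prime hv hv0 _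
  have hbdd : ∀ b, ‖b - a‖ ≤ ‖d‖ → ∀ k < N + (m + 1) + M, ‖(g b)^[k] x₀‖ ≤ 1 := by
    intro b hb k hk
    rcases le_total k (N + m) with h | h
    · exact S.norm_le_one F h (hball b hb)
    rcases h.eq_or_lt with h | h
    · exact S.norm_le_one F h.ge (hball b hb)
    obtain ⟨j, rfl⟩ := Nat.exists_eq_add_of_le (show N + (m + 1) ≤ k by omega)
    exact (hle b hb j (by omega)).trans (v_lt j (by omega)).le
  have hzero : ∀ j, ‖(g a)^[N + (m + 1) + j] x₀‖ ≤ (p : ℝ)⁻¹ ^ 2 := by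
    intro j
    induction j with
    | zero => rw [add_zero, ha0, norm_zero]; have := F.p_inv_pos; positivity
    | succ j ih =>
      rw [← add_assoc, Function.iterate_succ_apply']
      exact F.norm_map_le_inv_sq (S.norm_par_le haδ.le) ih
  have hgrow : ∀ j ≤ M, ‖(g (a + d))^[N + (m + 1) + j] x₀‖ = ‖v (M - j)‖ := by
    have hb : ‖a + d - a‖ ≤ ‖d‖ := by simp
    intro j
    induction j with
    | zero =>
      intro _
      have := hsub (a + d) a (hball _ hb) haδ
      rw [ha0, sub_zero, add_sub_cancel_left, hdκ] at this
      rw [add_zero, this, Nat.sub_zero]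
    | succ j ih =>
      intro hj
      have ih := ih (by omega)
      have hvj := hv (M - (j + 1))
      rw [show M - (j + 1) + 1 = M - j by omega] at hvj
      rw [← add_assoc, Function.iterate_succ_apply',
        (F.tame _ (S.norm_par_le (hball _ hb).le)).norm_eq _ (ih ▸ v_lt j (by omega)), ih, hvj]
      rw [ih, hvj]
      exact F.inv_sq_lt_inv.trans (inv_lt_norm_seq F.prime hv hv0 _)
  -- At time N + (m + 1) + M the distance to β is 1 for the parameter a, whose orbit is trapped near
  -- 0, and |v 0| > 1 for a + d; hence β is attained in between.
  obtain ⟨b, hb, hbβ⟩ : ∃ b, ‖b - a‖ ≤ ‖d‖ ∧ (g b)^[N + (m + 1) + M] x₀ = β := by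
    refine (F.isRatOn_iterate {b | ‖b - a‖ ≤ ‖d‖} x₀ (N + (m + 1) + M) hbdd).exists_eq
      (z := a + d) (by simp) ?_
    have h1 := hgrow M le_rfl
    rw [Nat.sub_self] at h1
    have h2 : ‖(g a)^[N + (m + 1) + M] x₀‖ < 1 :=
      (hzero M).trans_lt (F.inv_sq_lt_inv.trans F.p_inv_lt_one)
    rw [F.norm_sub_fix h2, sub_eq_add_neg, norm_add_eq_left_of_lt, h1]
    · exact hv0.ne'
    · rwa [norm_neg, F.norm_fix, h1]
  refine ⟨b, hball b hb, hbβ, ?_⟩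
  -- Induction backwards from the landing: the norm of an image on a circle t_k determines the norm
  -- of its preimage in the open unit ball.
  have main : ∀ i ≤ M, ‖(g b)^[N + (m + 1) + (M - i)] x₀‖ = returnRadius p i := by
    intro i
    induction i with
    | zero => intro _; rw [Nat.sub_zero, hbβ, F.norm_fix, returnRadius_zero]
    | succ i ih =>
      intro hi
      refine F.norm_eq_returnRadius_succ (S.norm_par_le (hball b hb).le)
        ((hle b hb _ (Nat.sub_le _ _)).trans_lt (v_lt _ (by omega))) ?_
      rw [← Function.iterate_succ_apply' (g b), ← ih (by omega),
        show (N + (m + 1) + (M - (i + 1))).succ = N + (m + 1) + (M - i) by omega]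
  intro j hj
  have := main (M - j) (Nat.sub_le _ _)
  rwa [show M - (M - j) = j by omega] at this

end Stage
end

/-! ### The inductive step from one stage to the next. -/

noncomputable section

open Ultra

variable {K : Type*} [NormedField K] [IsUltrametricDist K]

theorem TameFamily.norm_sub_le_of_circle {p : ℕ} {g : K → K → K} {β : K} (F : TameFamily p g β)
    {c c' z w : K} {k : ℕ} (hc : ‖c‖ ≤ (p : ℝ)⁻¹ ^ 2) (hw : ‖w‖ = returnRadius p (k + 1))
    (hzw : ‖z - w‖ ≤ (p : ℝ)⁻¹ ^ 2) :
    ‖g c z - g c' w‖ ≤ max (returnRadius p k * ‖z - w‖) (returnRadius p (k + 1) * ‖c - c'‖) := by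
  rw [← sub_add_sub_cancel _ (g c w)]
  exact (IsUltrametricDist.norm_add_le_max _ _).trans
    (max_le_max (F.norm_map_sub_le_of_circle hc hw hzw) (F.norm_par_sub_of_circle hw).le)

theorem TameFamily.norm_sub_eq_of_circle {p : ℕ} {g : K → K → K} {β : K} (F : TameFamily p g β)
    {c c' z w : K} {k : ℕ} (hc : ‖c‖ ≤ (p : ℝ)⁻¹ ^ 2) (hw : ‖w‖ = returnRadius p (k + 1))
    (hzw : ‖z - w‖ ≤ (p : ℝ)⁻¹ ^ 2)
    (hlt : returnRadius p k * ‖z - w‖ < returnRadius p (k + 1) * ‖c - c'‖) :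
    ‖g c z - g c' w‖ = returnRadius p (k + 1) * ‖c - c'‖ := by
  rw [← sub_add_sub_cancel _ (g c w), add_comm, norm_add_eq_left_of_lt,
    F.norm_par_sub_of_circle hw]
  rw [F.norm_par_sub_of_circle hw]
  exact (F.norm_map_sub_le_of_circle hc hw hzw).trans_lt hlt

namespace Stage

variable {p : ℕ} {g : K → K → K} {β x₀ c : K} {s : ℝ} {N m : ℕ}

/-- A long climb contracts everything inherited from the past below the contribution of its last
step, which is t_1|c' - c''| exactly. This restores the similarity of ratio t_1 and the smallness of
the disc, now with m + 3. -/
theorem exists_next [IsAlgClosed K] (F : TameFamily p g β) (S : Stage p g β x₀ s c N m) :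
    ∃ b N', N < N' ∧ ‖b - c‖ ≤ parRadius p m ∧ Stage p g β x₀ s b N' (m + 3) ∧
      ∀ c', ‖c' - b‖ ≤ parRadius p (m + 3) →
        (∀ k ≤ m, ‖(g c')^[N + k] x₀‖ = 1) ∧ ‖(g c')^[N + (m + 1)] x₀‖ < 1 := by
  have hp1 := F.one_lt
  have hp0 : (0 : ℝ) < p := by linarith
  have hπ := F.inv_sq_lt_inv
  have hπ0 : 0 < (p : ℝ)⁻¹ ^ 2 := by have := F.p_inv_pos; positivity
  set C := returnRadius p 1 with hCdef
  have hC : 0 < C := returnRadius_pos F.prime 1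
  have hC1 : C < 1 := returnRadius_succ_lt_one F.prime 0
  set κ : ℝ := p ^ (m + 1) * C with hκ
  have hCκ : C ≤ κ := le_mul_of_one_le_left hC.le (one_le_pow₀ hp1.le)
  have hκ0 : 0 < κ := hC.trans_le hCκ
  -- Origin of the 3: κ times `parRadius p m` is p, and three more factors p⁻¹ bring orbit
  -- variations within the p⁻² required by `contract`.
  have hκδ : κ * parRadius p (m + 3) = (p : ℝ)⁻¹ ^ 2 := by
    have := pow_mul_parRadius F.prime m
    rw [hκ, parRadius_add, pow_succ]
    calc (p : ℝ) ^ m * p * C * ((p : ℝ)⁻¹ ^ 3 * parRadius p m)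
        = (p : ℝ) * (p : ℝ)⁻¹ ^ 3 * ((p : ℝ) ^ m * (C * parRadius p m)) := by ring
      _ = (p : ℝ)⁻¹ ^ 2 := by rw [this]; field_simp
  obtain ⟨L, hL⟩ : ∃ L, C ^ L < ((p : ℝ) ^ (m + 4))⁻¹ :=
    exists_pow_lt_of_lt_one (by positivity) hC1
  have hL' : C ^ L * p ^ (m + 4) < 1 := by
    rwa [← lt_div_iff₀ (by positivity), one_div]
  have hLκ : C ^ L * κ < 1 := by
    refine lt_of_le_of_lt ?_ hL'
    gcongr
    rw [hκ]
    calc (p : ℝ) ^ (m + 1) * C ≤ (p : ℝ) ^ (m + 4) * 1 := by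
          gcongr
          · exact hp1.le
          · omega
      _ = _ := mul_one _
  -- The first L + 1 steps of the climb contract by at least t_1; the last, from t_1 to 1, only has
  -- factor 1. At times L and L + 1 of the climb the radii are t_2 and t_1.
  obtain ⟨b, hb, hbβ, hcirc⟩ := S.exists_landing F (M := L + 2) (by omega)
  have hδlt := parRadius_add_lt F.prime m (k := 3) (by norm_num)
  have hball : ∀ c', ‖c' - b‖ ≤ parRadius p (m + 3) → ‖c' - c‖ < parRadius p m := by
    intro c' h'
    rw [← sub_add_sub_cancel c' b c]
    exact norm_add_lt_of_lt (h'.trans_lt hδlt) hb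
  have hbb : ‖b - b‖ ≤ parRadius p (m + 3) := by
    rw [sub_self, norm_zero]
    exact (parRadius_pos F.prime _).le
  have hdist : ∀ c' c'', ‖c' - b‖ ≤ parRadius p (m + 3) → ‖c'' - b‖ ≤ parRadius p (m + 3) →
      ‖c' - c''‖ ≤ parRadius p (m + 3) := fun c' c'' h' h'' =>
    Ultra.norm_sub_le_of_norm_sub_le h' (by rwa [norm_sub_rev])
  have hmax : ∀ j, max (C ^ j * κ) C ≤ κ := fun j =>
    max_le (mul_le_of_le_one_left hκ0.le (pow_le_one₀ hC.le hC1.le)) hCκ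
  have hsmall : ∀ j c' c'', ‖c' - b‖ ≤ parRadius p (m + 3) → ‖c'' - b‖ ≤ parRadius p (m + 3) →
      max (C ^ j * κ) C * ‖c' - c''‖ ≤ (p : ℝ)⁻¹ ^ 2 := by
    intro j c' c'' h' h''
    rw [← hκδ]
    exact mul_le_mul (hmax j) (hdist c' c'' h' h'') (norm_nonneg _) hκ0.le
  have circle_of : ∀ j ≤ L + 2, ∀ z : K, ‖z - (g b)^[N + (m + 1) + j] x₀‖ ≤ (p : ℝ)⁻¹ ^ 2 →
      ‖z‖ = returnRadius p (L + 2 - j) := by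
    intro j hj z hz
    rw [← hcirc j hj]
    refine norm_eq_of_norm_sub_lt ?_
    rw [norm_sub_rev, hcirc j hj]
    exact hz.trans_lt (hπ.trans (inv_lt_returnRadius F.prime _))
  -- The first entry of the maximum is the inherited variation, the second the direct effect of the
  -- parameter during the climb.
  have hphase : ∀ j ≤ L + 1, ∀ c' c'', ‖c' - b‖ ≤ parRadius p (m + 3) →
      ‖c'' - b‖ ≤ parRadius p (m + 3) →
      ‖(g c')^[N + (m + 1) + j] x₀ - (g c'')^[N + (m + 1) + j] x₀‖
        ≤ max (C ^ j * κ) C * ‖c' - c''‖ := by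
    intro j
    induction j with
    | zero =>
      intro _ c' c'' h' h''
      rw [add_zero, S.norm_sub_eq F le_rfl (hball c' h') (hball c'' h''), pow_zero, one_mul,
        max_eq_left hCκ, hκ, mul_assoc]
    | succ j ih =>
      intro hj c' c'' h' h''
      have ih := ih (by omega)
      have hw := circle_of j (by omega) _ ((ih c'' b h'' hbb).trans (hsmall j c'' b h'' hbb))
      rw [show L + 2 - j = (L + 1 - j) + 1 by omega] at hw
      have hstep := F.norm_sub_le_of_circle (c' := c'') (S.norm_par_le (hball c' h').le) hw
        ((ih c' c'' h' h'').trans (hsmall j c' c'' h' h''))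
      rw [← add_assoc, Function.iterate_succ_apply', Function.iterate_succ_apply']
      refine hstep.trans (max_le ?_ ?_)
      · have hr : returnRadius p (L + 1 - j) ≤ C := returnRadius_antitone F.prime (by omega)
        calc returnRadius p (L + 1 - j) * _
            ≤ C * (max (C ^ j * κ) C * ‖c' - c''‖) := by
              gcongr
              exact ih c' c'' h' h''
          _ = max (C ^ (j + 1) * κ) (C * C) * ‖c' - c''‖ := by
              rw [← mul_assoc, mul_max_of_nonneg _ _ hC.le, pow_succ']
              ring_nf
          _ ≤ _ := by
              gcongr
              exact mul_le_of_le_one_left hC.le hC1.le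
      · gcongr
        exact (returnRadius_succ_le F.prime _).trans (le_max_right _ _)
  have hcirc' : ∀ c', ‖c' - b‖ ≤ parRadius p (m + 3) → ∀ j ≤ L + 1,
      ‖(g c')^[N + (m + 1) + j] x₀‖ = returnRadius p (L + 2 - j) := fun c' h' j hj =>
    circle_of j (by omega) _ ((hphase j hj c' b h' hbb).trans (hsmall j c' b h' hbb))
  -- At time L + 1 the inherited part is below t_1|c' - c''| by the choice of L, and the parameter
  -- at the previous step contributed only t_2|c' - c''|. The last step adds exactly t_1|c' - c''|,
  -- which wins strictly.
  have hsim : ∀ c' c'', ‖c' - b‖ ≤ parRadius p (m + 3) → ‖c'' - b‖ ≤ parRadius p (m + 3) →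
      ‖(g c')^[N + (m + 1) + (L + 2)] x₀ - (g c'')^[N + (m + 1) + (L + 2)] x₀‖
        = C * ‖c' - c''‖ := by
    intro c' c'' h' h''
    rcases eq_or_ne c' c'' with rfl | hne
    · simp
    have hd : 0 < ‖c' - c''‖ := norm_pos_iff.2 (sub_ne_zero.2 hne)
    have hw := hcirc' c'' h'' (L + 1) le_rfl
    rw [show L + 2 - (L + 1) = 0 + 1 by omega] at hw
    have hw2 := hcirc' c'' h'' L (by omega)
    rw [show L + 2 - L = 1 + 1 by omega] at hw2
    have hlast := (hphase (L + 1) le_rfl c' c'' h' h'').trans (hsmall _ c' c'' h' h'')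
    rw [show N + (m + 1) + (L + 2) = N + (m + 1) + (L + 1) + 1 by ring,
      Function.iterate_succ_apply', Function.iterate_succ_apply',
      F.norm_sub_eq_of_circle (S.norm_par_le (hball c' h').le) hw hlast]
    rw [returnRadius_zero, one_mul, ← add_assoc, Function.iterate_succ_apply',
      Function.iterate_succ_apply']
    refine (F.norm_sub_le_of_circle (S.norm_par_le (hball c' h').le) hw2
      ((hphase L (by omega) c' c'' h' h'').trans (hsmall L c' c'' h' h''))).trans_lt
      (max_lt ?_ ?_)
    · refine mul_lt_mul_of_pos_left ((hphase L (by omega) c' c'' h' h'').trans_lt ?_) hC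
      exact mul_lt_of_lt_one_left hd (max_lt hLκ hC1)
    · exact mul_lt_mul_of_pos_right (returnRadius_succ_lt F.prime 1) hd
  have hclose : ∀ c', ‖c' - b‖ ≤ parRadius p (m + 3) → ∀ x, ‖x - x₀‖ ≤ s → ∀ j ≤ L + 1,
      ‖(g c')^[N + (m + 1) + j] x - (g c')^[N + (m + 1) + j] x₀‖ ≤ (p : ℝ)⁻¹ ^ 2 * C ^ j := by
    intro c' h' x hx j
    induction j with
    | zero =>
      intro _
      refine (S.close_of_le F le_rfl (hball c' h') hx).trans_eq ?_
      rw [inv_pow _ (m + 1)]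
      field_simp
    | succ j ih =>
      intro hj
      have ih := ih (by omega)
      have hw := hcirc' c' h' j (by omega)
      rw [show L + 2 - j = (L + 1 - j) + 1 by omega] at hw
      rw [← add_assoc, Function.iterate_succ_apply', Function.iterate_succ_apply']
      refine (F.norm_map_sub_le_of_circle (S.norm_par_le (hball c' h').le) hw (ih.trans
        (mul_le_of_le_one_right hπ0.le (pow_le_one₀ hC.le hC1.le)))).trans ?_
      have hr : returnRadius p (L + 1 - j) ≤ C := returnRadius_antitone F.prime (by omega)
      calc returnRadius p (L + 1 - j) * _ ≤ C * ((p : ℝ)⁻¹ ^ 2 * C ^ j) := by gcongr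
        _ = _ := by ring
  have hend : ∀ c', ‖c' - b‖ ≤ parRadius p (m + 3) → ∀ x, ‖x - x₀‖ ≤ s →
      ‖(g c')^[N + (m + 1) + (L + 2)] x - (g c')^[N + (m + 1) + (L + 2)] x₀‖
        ≤ (p : ℝ)⁻¹ ^ 2 * (p : ℝ)⁻¹ ^ (m + 3 + 1) := by
    intro c' h' x hx
    have hw := hcirc' c' h' (L + 1) le_rfl
    rw [show L + 2 - (L + 1) = 0 + 1 by omega] at hw
    have hlast := hclose c' h' x hx (L + 1) le_rfl
    rw [show N + (m + 1) + (L + 2) = N + (m + 1) + (L + 1) + 1 by ring,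
      Function.iterate_succ_apply', Function.iterate_succ_apply']
    refine (F.norm_map_sub_le_of_circle (S.norm_par_le (hball c' h').le) hw (hlast.trans
      (mul_le_of_le_one_right hπ0.le (pow_le_one₀ hC.le hC1.le)))).trans ?_
    rw [returnRadius_zero, one_mul]
    refine hlast.trans ?_
    gcongr
    rw [inv_pow, pow_succ]
    exact (mul_le_of_le_one_right (by positivity) hC1.le).trans hL.le
  refine ⟨b, N + (m + 1) + (L + 2), by omega, hb.le, ⟨S.norm_par_le hb.le,
    hδlt.le.trans S.parRadius_le, hbβ, hsim, fun c' h' k hk => ?_, fun c' h' x hx k hk => ?_,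
    hend⟩, fun c' h' => ⟨fun k hk => ?_, ?_⟩⟩
  · rcases le_or_gt k (N + m) with h | h
    · exact S.norm_le_one F h (hball c' h')
    obtain ⟨j, rfl⟩ := Nat.exists_eq_add_of_le (show N + (m + 1) ≤ k by omega)
    rcases le_or_gt j (L + 1) with hj | hj
    · rw [hcirc' c' h' j hj]
      exact returnRadius_le_one F.prime _
    obtain rfl : j = L + 2 := by omega
    rw [← sub_add_cancel ((g c')^[N + (m + 1) + (L + 2)] x₀) β]
    refine Ultra.norm_add_le_of_le ?_ F.norm_fix.le
    have := hsim c' b h' hbb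
    rw [hbβ] at this
    rw [this]
    calc C * ‖c' - b‖ ≤ max (C ^ 0 * κ) C * ‖c' - b‖ := by gcongr; exact le_max_right _ _
      _ ≤ _ := hsmall 0 c' b h' hbb
      _ ≤ 1 := (hπ.trans F.p_inv_lt_one).le
  · rcases le_total k N with h | h
    · exact S.close c' (hball c' h').le x hx k h
    rcases le_or_gt k (N + (m + 1)) with h2 | h2
    · obtain ⟨j, rfl⟩ := Nat.exists_eq_add_of_le h
      refine (S.close_of_le F (by omega) (hball c' h') hx).trans ?_
      calc (p : ℝ) ^ j * ((p : ℝ)⁻¹ ^ 2 * (p : ℝ)⁻¹ ^ (m + 1))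
          ≤ (p : ℝ) ^ (m + 1) * ((p : ℝ)⁻¹ ^ 2 * (p : ℝ)⁻¹ ^ (m + 1)) := by
            gcongr
            · exact hp1.le
            · omega
        _ = (p : ℝ)⁻¹ ^ 2 := by
            rw [inv_pow _ (m + 1)]
            field_simp
    obtain ⟨j, rfl⟩ := Nat.exists_eq_add_of_le h2.le
    rcases le_or_gt j (L + 1) with hj | hj
    · exact (hclose c' h' x hx j hj).trans
        (mul_le_of_le_one_right hπ0.le (pow_le_one₀ hC.le hC1.le))
    obtain rfl : j = L + 2 := by omega
    exact (hend c' h' x hx).trans (mul_le_of_le_one_right hπ0.le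
      (pow_le_one₀ F.p_inv_pos.le F.p_inv_lt_one.le))
  · exact F.norm_eq_one_of_near (S.norm_sub_fix_lt_one F hk (hball c' h'))
  · have := hcirc' c' h' 0 (by omega)
    rw [add_zero] at this
    rw [this, show L + 2 - 0 = (L + 1) + 1 by omega]
    exact returnRadius_succ_lt_one F.prime _

end Stage
end

/-! ### The limit parameter and its itinerary. -/

noncomputable section

open Ultra

variable {K : Type*} [NormedField K] [IsUltrametricDist K]
  {p : ℕ} {g : K → K → K} {β : K}

/-- The parameter balls of successive stages are nested with radii tending to 0, and their common
point inherits the estimates of every stage. -/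
theorem Stage.exists_limit [IsAlgClosed K] [CompleteSpace K] (F : TameFamily p g β)
    {x₀ c₀ : K} {s : ℝ} {N₀ m₀ : ℕ} (S : Stage p g β x₀ s c₀ N₀ m₀) :
    ∃ c, ‖c - c₀‖ ≤ parRadius p m₀ ∧ (∀ k, ‖(g c)^[k] x₀‖ ≤ 1) ∧
      (∀ x, ‖x - x₀‖ ≤ s → ∀ k, ‖(g c)^[k] x - (g c)^[k] x₀‖ ≤ (p : ℝ)⁻¹ ^ 2) ∧
      ∀ n₀ d, ∃ N, n₀ ≤ N ∧ (∀ k ≤ d, ‖(g c)^[N + k] x₀‖ = 1) ∧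
        ∃ n, N ≤ n ∧ ‖(g c)^[n] x₀‖ < 1 := by
  choose! nb nN hnN hnb hnS hnI using
    fun (c : K) (N m : ℕ) (S : Stage p g β x₀ s c N m) => S.exists_next F
  let σ : ℕ → K × ℕ := fun i => Nat.rec (c₀, N₀)
    (fun i q => (nb q.1 q.2 (m₀ + 3 * i), nN q.1 q.2 (m₀ + 3 * i))) i
  have hS : ∀ i, Stage p g β x₀ s (σ i).1 (σ i).2 (m₀ + 3 * i) := by
    intro i
    induction i with
    | zero => exact S
    | succ i ih => exact hnS _ _ _ ih
  -- So the bounds of stage k, valid up to its hitting time, cover the time k.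
  have hN : ∀ i, i ≤ (σ i).2 := by
    intro i
    induction i with
    | zero => exact Nat.zero_le _
    | succ i ih => exact lt_of_le_of_lt ih (hnN _ _ _ (hS i))
  have hanti : ∀ i j, parRadius p (m₀ + 3 * (i + j)) ≤ parRadius p (m₀ + 3 * i) := by
    intro i j
    rw [mul_add, ← add_assoc, parRadius_add]
    exact mul_le_of_le_one_left (parRadius_pos F.prime _).le
      (pow_le_one₀ F.p_inv_pos.le F.p_inv_lt_one.le)
  have hnest : ∀ i j, ‖(σ (i + j)).1 - (σ i).1‖ ≤ parRadius p (m₀ + 3 * i) := by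
    intro i j
    induction j with
    | zero => simpa using (parRadius_pos F.prime _).le
    | succ j ih =>
      exact Ultra.norm_sub_le_of_norm_sub_le ((hnb _ _ _ (hS (i + j))).trans (hanti i j)) ih
  have htend : Filter.Tendsto (fun i => parRadius p (m₀ + 3 * i)) Filter.atTop (𝓝 0) := by
    have h1 : Filter.Tendsto (fun i : ℕ => ((p : ℝ)⁻¹ ^ 3) ^ i * parRadius p m₀) Filter.atTop
        (𝓝 (0 * parRadius p m₀)) :=
      (tendsto_pow_atTop_nhds_zero_of_lt_one (by have := F.p_inv_pos; positivity)
        (pow_lt_one₀ F.p_inv_pos.le F.p_inv_lt_one (by norm_num))).mul_const _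
    rw [zero_mul] at h1
    refine h1.congr fun i => ?_
    rw [parRadius_add, pow_mul]
  have hcauchy : CauchySeq fun i => (σ i).1 := by
    refine cauchySeq_of_le_tendsto_0 _ (fun n m k hn hm => ?_) htend
    obtain ⟨a, rfl⟩ := Nat.exists_eq_add_of_le hn
    obtain ⟨b, rfl⟩ := Nat.exists_eq_add_of_le hm
    rw [dist_eq_norm]
    exact Ultra.norm_sub_le_of_norm_sub_le (hnest k a) (by rw [norm_sub_rev]; exact hnest k b)
  obtain ⟨c, hc⟩ := cauchySeq_tendsto_of_complete hcauchy
  have hci : ∀ i, ‖c - (σ i).1‖ ≤ parRadius p (m₀ + 3 * i) := by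
    intro i
    refine le_of_tendsto (hc.sub_const (σ i).1).norm ?_
    filter_upwards [Filter.eventually_ge_atTop i] with j hj
    obtain ⟨a, rfl⟩ := Nat.exists_eq_add_of_le hj
    exact hnest i a
  refine ⟨c, hci 0, fun k => (hS k).bounded c (hci k) k (hN k),
    fun x hx k => (hS k).close c (hci k) x hx k (hN k), fun n₀ d => ?_⟩
  -- The index n₀ + d makes both the starting time at least n₀ and the stay near β at least d steps
  -- long.
  obtain ⟨h1, h2⟩ := hnI _ _ _ (hS (n₀ + d)) c (hci (n₀ + d + 1))
  exact ⟨(σ (n₀ + d)).2, (Nat.le_add_right _ _).trans (hN _), fun k hk => h1 k (by omega), _,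
    Nat.le_add_right _ _, h2⟩

theorem TameFamily.exists_preimage_fix [IsAlgClosed K] (F : TameFamily p g β) :
    ∃ x₀, ‖x₀‖ = returnRadius p 1 ∧ g 0 x₀ = β := by
  obtain ⟨v, hv0, hv0', hv⟩ := exists_norm_pow_seq F.prime F.norm_p
  have hπ0 : 0 ≤ (p : ℝ)⁻¹ ^ 2 := by have := F.p_inv_pos; positivity
  have h0 : ‖(0 : K)‖ ≤ (p : ℝ)⁻¹ ^ 2 := by rwa [norm_zero]
  have hv1 := norm_seq_succ_lt_one F.prime hv hv0' 0
  obtain ⟨x₀, hx, hβ⟩ : ∃ x₀, ‖x₀ - 0‖ ≤ ‖v 1‖ ∧ g 0 x₀ = β := by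
    refine (F.rat {z | ‖z - 0‖ ≤ ‖v 1‖} (fun z => z) (fun _ => 0) (IsRatOn.id _)
      (IsRatOn.const _ 0) fun z hz => ?_).exists_eq (z := v 1) (by simp) ?_
    · rw [Set.mem_ofPred_eq, sub_zero] at hz
      exact hz.trans hv1.le
    · have h1 : ‖g 0 (v 1)‖ = ‖v 0‖ := by
        rw [(F.tame 0 h0).norm_eq _ hv1, hv]
        rw [hv]
        exact F.inv_sq_lt_inv.trans (inv_lt_norm_seq F.prime hv hv0 0)
      have h2 : ‖g 0 0‖ < 1 :=
        (F.norm_map_le_inv_sq h0 h0).trans_lt (F.inv_sq_lt_inv.trans F.p_inv_lt_one)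
      rw [F.norm_sub_fix h2, sub_eq_add_neg, norm_add_eq_left_of_lt, h1]
      · exact hv0.ne'
      · rwa [norm_neg, F.norm_fix, h1]
  rw [sub_zero] at hx
  exact ⟨x₀, F.norm_eq_returnRadius_succ h0 (hx.trans_lt hv1)
    (by rw [hβ, F.norm_fix, returnRadius_zero]), hβ⟩

/-- A point on the circle t_1 already depends on the parameter by a similarity of ratio t_1 after
one step. That step may cost a factor p, whence the exponent m + 4 = 1 + 2 + (m + 1). -/
theorem TameFamily.stage_zero (F : TameFamily p g β) {x₀ : K} (hx₀ : ‖x₀‖ = returnRadius p 1)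
    (hβ : g 0 x₀ = β) {m : ℕ} (hm : parRadius p m ≤ (p : ℝ)⁻¹ ^ 2) :
    Stage p g β x₀ ((p : ℝ)⁻¹ ^ (m + 4)) 0 1 m := by
  have hp1 := F.one_lt
  have hi0 := F.p_inv_pos
  have hi1 := F.p_inv_lt_one
  have hπ0 : 0 ≤ (p : ℝ)⁻¹ ^ 2 := by positivity
  have hx1 : ‖x₀‖ ≤ 1 := hx₀ ▸ returnRadius_le_one F.prime 1
  have hsim : ∀ c' c'', ‖g c' x₀ - g c'' x₀‖ = returnRadius p 1 * ‖c' - c''‖ := fun c' c'' =>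
    F.norm_par_sub_of_circle hx₀
  have hend : ∀ c', ‖c' - 0‖ ≤ parRadius p m → ∀ x, ‖x - x₀‖ ≤ (p : ℝ)⁻¹ ^ (m + 4) →
      ‖g c' x - g c' x₀‖ ≤ (p : ℝ)⁻¹ ^ 2 * (p : ℝ)⁻¹ ^ (m + 1) := by
    intro c' h' x hx
    rw [sub_zero] at h'
    have hx' : ‖x‖ ≤ 1 := by
      rw [← sub_add_cancel x x₀]
      exact Ultra.norm_add_le_of_le (hx.trans (pow_le_one₀ hi0.le hi1.le)) hx1
    refine ((F.tame c' (h'.trans hm)).lip x x₀ hx' hx1).trans ?_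
    calc (p : ℝ) * ‖x - x₀‖ ≤ p * (p : ℝ)⁻¹ ^ (m + 4) := by gcongr
      _ = (p : ℝ) * (p : ℝ)⁻¹ * ((p : ℝ)⁻¹ ^ 2 * (p : ℝ)⁻¹ ^ (m + 1)) := by ring
      _ = _ := by rw [mul_inv_cancel₀ (by linarith), one_mul]
  refine ⟨by rwa [norm_zero], hm, hβ, fun c' c'' _ _ => hsim c' c'', fun c' h' k hk => ?_,
    fun c' h' x hx k hk => ?_, hend⟩
  · rcases Nat.le_one_iff_eq_zero_or_eq_one.1 hk with rfl | rfl
    · exact hx1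
    · have h := hsim c' 0
      rw [hβ] at h
      rw [Function.iterate_one, ← sub_add_cancel (g c' x₀) β]
      refine Ultra.norm_add_le_of_le ?_ F.norm_fix.le
      rw [h]
      exact mul_le_one₀ (returnRadius_le_one F.prime 1) (norm_nonneg _)
        (h'.trans (hm.trans (F.inv_sq_lt_inv.trans hi1).le))
  · rcases Nat.le_one_iff_eq_zero_or_eq_one.1 hk with rfl | rfl
    · exact hx.trans (pow_le_pow_of_le_one hi0.le hi1.le (by omega))
    · exact (hend c' h' x hx).trans (mul_le_of_le_one_right hπ0 (pow_le_one₀ hi0.le hi1.le))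

/-- Arbitrarily close to `0` there is a parameter for which some disc has all its images in the
unit ball and of diameter less than `1`, and an itinerary with respect to the open unit ball which
is not eventually periodic. -/
theorem TameFamily.exists_wandering [IsAlgClosed K] [CompleteSpace K] (F : TameFamily p g β)
    {ε : ℝ} (hε : 0 < ε) :
    ∃ c x₀ : K, ∃ m : ℕ, ‖c‖ ≤ ε ∧ (∀ k, ‖(g c)^[k] x₀‖ ≤ 1) ∧
      (∀ x, ‖x - x₀‖ ≤ (p : ℝ)⁻¹ ^ m → ∀ k, ‖(g c)^[k] x - (g c)^[k] x₀‖ < 1) ∧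
      ∀ n₀ d, 0 < d → ¬ ∀ n, n₀ ≤ n → (‖(g c)^[n] x₀‖ < 1 ↔ ‖(g c)^[n + d] x₀‖ < 1) := by
  have hi0 := F.p_inv_pos
  have hi1 := F.p_inv_lt_one
  obtain ⟨x₀, hx₀, hβ⟩ := F.exists_preimage_fix
  have hπ0 : 0 < (p : ℝ)⁻¹ ^ 2 := by positivity
  obtain ⟨m, hm⟩ : ∃ m, parRadius p m < min ε ((p : ℝ)⁻¹ ^ 2) := by
    obtain ⟨m, hm⟩ := exists_pow_lt_of_lt_one
      (mul_pos (lt_min hε hπ0) (returnRadius_pos F.prime 1)) hi1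
    exact ⟨m, (div_lt_iff₀ (returnRadius_pos F.prime 1)).2 hm⟩
  obtain ⟨c, hc, h1, h2, h3⟩ :=
    (F.stage_zero hx₀ hβ (hm.le.trans (min_le_right _ _))).exists_limit F
  rw [sub_zero] at hc
  refine ⟨c, x₀, m + 4, hc.trans (hm.le.trans (min_le_left _ _)), h1,
    fun x hx k => (h2 x hx k).trans_lt (F.inv_sq_lt_inv.trans hi1), fun n₀ d hd hper => ?_⟩
  obtain ⟨N, hN, hone, n, hn, hlt⟩ := h3 n₀ d
  -- With period d, a run of d + 1 times of norm 1 would continue forever.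
  have hall : ∀ j, ¬ ‖(g c)^[N + j] x₀‖ < 1 := by
    intro j
    induction j using Nat.strong_induction_on with
    | _ j ih =>
      rcases le_or_gt j d with h | h
      · exact (hone j h).not_lt
      · have := ih (j - d) (by omega)
        rwa [hper _ (by omega), show N + (j - d) + d = N + j by omega] at this
  obtain ⟨j, rfl⟩ := Nat.exists_eq_add_of_le hn
  exact hall j hlt
end

/-! ### Power series expansions and polynomial perturbations in R_B. -/

noncomputable section

open Ultra

section PowerSeries

variable {K : Type*} [NormedField K]

theorem Polynomial.hasSum_coeff_mul_pow (N : Polynomial K) (z : K) :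
    HasSum (fun i => N.coeff i * z ^ i) (N.eval z) := by
  rw [Polynomial.eval_eq_sum_range]
  refine hasSum_sum_of_ne_finset_zero fun i hi => ?_
  rw [Polynomial.coeff_eq_zero_of_natDegree_lt (by simpa using hi), zero_mul]

theorem Polynomial.summable_norm_coeff_mul_pow (N : Polynomial K) (z : K) :
    Summable fun i => ‖N.coeff i * z ^ i‖ := by
  refine summable_of_ne_finset_zero (s := Finset.range (N.natDegree + 1)) fun i hi => ?_
  rw [Polynomial.coeff_eq_zero_of_natDegree_lt (by simpa using hi), zero_mul, norm_zero]

variable [CompleteSpace K]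

/-- If `Δ * D = N` with polynomials `D` and `N`, then this holds for the values at every point at
which `Δ` converges absolutely. -/
theorem PowerSeries.tsum_mul_eval {Δ : PowerSeries K} {D N : Polynomial K}
    (h : Δ * (D : PowerSeries K) = N) {z : K}
    (hs : Summable fun i => ‖PowerSeries.coeff i Δ * z ^ i‖) :
    (∑' i, PowerSeries.coeff i Δ * z ^ i) * D.eval z = N.eval z := by
  rw [← (D.hasSum_coeff_mul_pow z).tsum_eq, ← (N.hasSum_coeff_mul_pow z).tsum_eq,
    tsum_mul_tsum_eq_tsum_sum_antidiagonal_of_summable_norm hs (D.summable_norm_coeff_mul_pow z)]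
  refine tsum_congr fun n => ?_
  rw [← Polynomial.coeff_coe, ← h, PowerSeries.coeff_mul, Finset.sum_mul]
  refine Finset.sum_congr rfl fun ij hij => ?_
  rw [← Finset.HasAntidiagonal.mem_antidiagonal.1 hij, pow_add, Polynomial.coeff_coe]
  ring

/-- As r > 1, the series converges geometrically on the unit ball; there the ultrametric inequality
passes termwise bounds, also for z^i - w^i, to the sum. -/
theorem PowerSeries.smallOnBall_tsum [IsUltrametricDist K] {Δ : PowerSeries K} {η r : ℝ}
    (hη : 0 ≤ η) (hr : 1 < r) (h : ∀ i, ‖PowerSeries.coeff i Δ‖ * r ^ i ≤ η) :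
    (∀ z : K, ‖z‖ ≤ 1 → Summable fun i => ‖PowerSeries.coeff i Δ * z ^ i‖) ∧
      SmallOnBall η fun z => ∑' i, PowerSeries.coeff i Δ * z ^ i := by
  have hr0 : 0 < r := by linarith
  have h1 : ∀ i, ‖PowerSeries.coeff i Δ‖ ≤ η := fun i =>
    (le_mul_of_one_le_right (norm_nonneg _) (one_le_pow₀ hr.le)).trans (h i)
  have hs : ∀ z : K, ‖z‖ ≤ 1 → Summable fun i => ‖PowerSeries.coeff i Δ * z ^ i‖ := by
    intro z hz
    refine Summable.of_nonneg_of_le (fun i => norm_nonneg _) (fun i => ?_)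
      ((summable_geometric_of_lt_one (inv_nonneg.2 hr0.le) (inv_lt_one_of_one_lt₀ hr)).mul_left η)
    rw [norm_mul, norm_pow, inv_pow, ← div_eq_mul_inv, le_div_iff₀ (by positivity)]
    calc ‖PowerSeries.coeff i Δ‖ * ‖z‖ ^ i * r ^ i ≤ ‖PowerSeries.coeff i Δ‖ * 1 * r ^ i := by
          gcongr
          exact pow_le_one₀ (norm_nonneg _) hz
      _ ≤ η := by rw [mul_one]; exact h i
  refine ⟨hs, fun z hz => ?_, fun z w hz hw => ?_⟩
  · refine IsUltrametricDist.norm_tsum_le_of_forall_le_of_nonneg hη fun i => ?_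
    rw [norm_mul, norm_pow]
    exact (mul_le_of_le_one_right (norm_nonneg _) (pow_le_one₀ (norm_nonneg _) hz)).trans (h1 i)
  · rw [← (hs z hz).of_norm.tsum_sub (hs w hw).of_norm]
    refine IsUltrametricDist.norm_tsum_le_of_forall_le_of_nonneg (by positivity) fun i => ?_
    rw [← mul_sub, norm_mul]
    gcongr
    · exact h1 i
    · rcases i with _ | i
      · simp
      · simpa using norm_pow_sub_pow_le hz hw i

end PowerSeries

namespace RegularRatFunc

variable {p : ℕ} [Fact p.Prime] {r : ℝ}

theorem toFun_eq (f : RegularRatFunc p r) (z : ℂ_[p]) :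
    f.toFun z = f.1.num.eval z / f.1.denom.eval z := rfl

theorem isRatOn_toFun (f : RegularRatFunc p r) {S : Set ℂ_[p]} {φ : ℂ_[p] → ℂ_[p]}
    (hφ : IsRatOn S φ) (h : ∀ c ∈ S, ‖φ c‖ ≤ r) : IsRatOn S fun c => f.toFun (φ c) := by
  simp only [toFun_eq, div_eq_mul_inv]
  exact (hφ.eval_comp _).mul ((hφ.eval_comp _).inv fun c hc => f.2 _ (h c hc))

theorem expansion_mul_denom (hr : 0 ≤ r) (f : RegularRatFunc p r) :
    f.expansion * (f.1.denom : PowerSeries ℂ_[p]) = f.1.num := by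
  have h0 : PowerSeries.constantCoeff (f.1.denom : PowerSeries ℂ_[p]) ≠ 0 := by
    rw [← PowerSeries.coeff_zero_eq_constantCoeff_apply, Polynomial.coeff_coe,
      Polynomial.coeff_zero_eq_eval_zero]
    exact f.2 0 (by rwa [norm_zero])
  rw [expansion, mul_assoc, PowerSeries.inv_mul_cancel _ h0, mul_one]

/-- The sum of an element of `R_B` and a polynomial. -/
def addPoly (f : RegularRatFunc p r) (Q : Polynomial ℂ_[p]) : RegularRatFunc p r :=
  ⟨f.1 + algebraMap _ _ Q, fun z hz h => f.2 z hz <| by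
    have hdvd := RatFunc.denom_add_dvd f.1 (algebraMap _ _ Q)
    rw [RatFunc.denom_algebraMap, mul_one] at hdvd
    exact Polynomial.eval_eq_zero_of_dvd_of_eval_eq_zero hdvd h⟩

theorem toFun_addPoly (f : RegularRatFunc p r) (Q : Polynomial ℂ_[p]) {z : ℂ_[p]} (hz : ‖z‖ ≤ r) :
    (f.addPoly Q).toFun z = f.toFun z + Q.eval z := by
  have h := RatFunc.eval_add (f := RingHom.id ℂ_[p]) (a := z) (x := f.1)
    (y := algebraMap _ (RatFunc ℂ_[p]) Q) (f.2 z hz) (by simp)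
  refine h.trans ?_
  congr 1
  simp [RatFunc.eval]

theorem expansion_addPoly (hr : 0 ≤ r) (f : RegularRatFunc p r) (Q : Polynomial ℂ_[p]) :
    (f.addPoly Q).expansion = f.expansion + Q := by
  have hf := f.expansion_mul_denom hr
  have hg := (f.addPoly Q).expansion_mul_denom hr
  -- The two reduced fractions are compared by cross-multiplication, with no need to identify their
  -- denominators.
  have hpoly : (f.addPoly Q).1.num * f.1.denom
      = (f.addPoly Q).1.denom * (f.1.num + Q * f.1.denom) := by
    apply RatFunc.algebraMap_injective ℂ_[p]
    have h1 := RatFunc.num_div_denom f.1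
    have h2 := RatFunc.num_div_denom (f.addPoly Q).1
    have d1 := RatFunc.algebraMap_ne_zero (RatFunc.denom_ne_zero f.1)
    have d2 := RatFunc.algebraMap_ne_zero (RatFunc.denom_ne_zero (f.addPoly Q).1)
    rw [div_eq_iff d1] at h1
    rw [div_eq_iff d2] at h2
    rw [map_mul, map_mul, map_add, map_mul, h1, h2]
    change (f.1 + algebraMap _ _ Q) * _ * _ = _
    ring
  have hps : ((f.addPoly Q).1.num : PowerSeries ℂ_[p]) * (f.1.denom : PowerSeries ℂ_[p])
      = ((f.addPoly Q).1.denom : PowerSeries ℂ_[p]) * (f.1.num + Q * f.1.denom) := by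
    exact_mod_cast congrArg (fun A : Polynomial ℂ_[p] => (A : PowerSeries ℂ_[p])) hpoly
  have e1 : (f.1.denom : PowerSeries ℂ_[p]) ≠ 0 := by
    exact_mod_cast RatFunc.denom_ne_zero f.1
  have e2 : ((f.addPoly Q).1.denom : PowerSeries ℂ_[p]) ≠ 0 := by
    exact_mod_cast RatFunc.denom_ne_zero (f.addPoly Q).1
  apply mul_right_cancel₀ (mul_ne_zero e2 e1)
  rw [← mul_assoc, hg, hps, ← hf]
  ring

theorem edist_addPoly_le (hr : 1 < r) (f : RegularRatFunc p r) (c β : ℂ_[p]) (hβ : ‖β‖ ≤ 1) :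
    edist f (f.addPoly (.C c * (.X * (.X - .C β)))) ≤ ENNReal.ofReal (‖c‖ * r ^ 2) := by
  have hr0 : 0 ≤ r := by linarith
  change ballNorm r _ ≤ _
  rw [expansion_addPoly hr0, sub_add_cancel_left, ballNorm_neg]
  refine iSup_le fun i => ?_
  rw [← ofReal_norm, ← ENNReal.ofReal_pow hr0, ← ENNReal.ofReal_mul (norm_nonneg _)]
  apply ENNReal.ofReal_le_ofReal
  have hQ : (Polynomial.C c * (Polynomial.X * (Polynomial.X - Polynomial.C β)) :
      Polynomial ℂ_[p]) = .C c * .X ^ 2 - .C (c * β) * .X ^ 1 := by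
    rw [map_mul]
    ring
  rw [Polynomial.coeff_coe, hQ, Polynomial.coeff_sub, Polynomial.coeff_C_mul_X_pow,
    Polynomial.coeff_C_mul_X_pow]
  rcases eq_or_ne i 2 with rfl | h2
  · simp
  rcases eq_or_ne i 1 with rfl | h1
  · simp only [OfNat.one_ne_ofNat, if_false, if_true, zero_sub, norm_neg, norm_mul]
    exact mul_le_mul (mul_le_of_le_one_right (norm_nonneg _) hβ)
      (pow_le_pow_right₀ hr.le one_le_two) (by positivity) (norm_nonneg _)
  · simp only [h1, h2, if_false, sub_zero, norm_zero, zero_mul]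
    positivity

end RegularRatFunc
end

/-! ### Maps near P_λ: tame families and the wandering criterion. -/

noncomputable section

open Ultra

namespace RegularRatFunc

variable {p : ℕ} [Fact p.Prime] {r : ℝ}

theorem norm_natCast_prime : ‖(p : ℂ_[p])‖ = (p : ℝ)⁻¹ := by
  rw [← map_natCast (algebraMap ℚ_[p] ℂ_[p]) p, norm_algebraMap', Padic.norm_p]

theorem expansion_benedettoMap (lam : ℂ_[p]) :
    (benedettoMap p r lam).expansion = (benedettoPoly p lam : PowerSeries ℂ_[p]) := by
  have h1 : (benedettoMap p r lam).1.num = benedettoPoly p lam := RatFunc.num_algebraMap _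
  have h2 : (benedettoMap p r lam).1.denom = 1 := RatFunc.denom_algebraMap _
  rw [expansion, h1, h2, Polynomial.coe_one, PowerSeries.inv_eq_iff_mul_eq_one (by simp) |>.2
    (one_mul _), mul_one]

theorem eval_benedettoPoly (lam z : ℂ_[p]) :
    (benedettoPoly p lam).eval z = lam / p * z ^ p + (1 - lam / p) * z ^ (p + 1) := by
  simp [benedettoPoly]

/-- On the unit ball, `f` differs from `P_λ` by a function as small as the distance. -/
theorem exists_smallOnBall (hr : 1 < r) {η : ℝ} (hη : 0 ≤ η) {lam : ℂ_[p]}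
    {f : RegularRatFunc p r} (hf : edist f (benedettoMap p r lam) ≤ ENNReal.ofReal η) :
    ∃ G, SmallOnBall η G ∧ ∀ z, ‖z‖ ≤ 1 →
      f.toFun z = lam / p * z ^ p + (1 - lam / p) * z ^ (p + 1) + G z := by
  have hr0 : 0 ≤ r := by linarith
  set Δ := f.expansion - (benedettoPoly p lam : PowerSeries ℂ_[p]) with hΔ
  have hcoeff : ∀ i, ‖PowerSeries.coeff i Δ‖ * r ^ i ≤ η := by
    intro i
    have h : ballNorm r Δ ≤ ENNReal.ofReal η := by
      rw [hΔ, ← expansion_benedettoMap (r := r)]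
      exact hf
    have hi := (le_iSup (fun i => ‖PowerSeries.coeff i Δ‖ₑ * ENNReal.ofReal r ^ i) i).trans h
    rwa [← ofReal_norm, ← ENNReal.ofReal_pow hr0, ← ENNReal.ofReal_mul (norm_nonneg _),
      ENNReal.ofReal_le_ofReal_iff hη] at hi
  obtain ⟨hs, hG⟩ := PowerSeries.smallOnBall_tsum hη hr hcoeff
  refine ⟨_, hG, fun z hz => ?_⟩
  have hmul : Δ * (f.1.denom : PowerSeries ℂ_[p])
      = ((f.1.num - benedettoPoly p lam * f.1.denom : Polynomial ℂ_[p]) :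
        PowerSeries ℂ_[p]) := by
    rw [hΔ, sub_mul, f.expansion_mul_denom hr0, Polynomial.coe_sub, Polynomial.coe_mul]
  have hden := f.2 z (hz.trans hr.le)
  have hval := PowerSeries.tsum_mul_eval hmul (hs z hz)
  rw [← eq_div_iff hden] at hval
  rw [hval, ← eval_benedettoPoly, toFun_eq, Polynomial.eval_sub, Polynomial.eval_mul]
  field_simp
  ring

/-- P_λ fixes 1, so f(z) - z has norm less than 1 at z = 1. At 1 + p the expansion turns the
displacement p into norm 1, so f(z) - z has norm 1; hence it vanishes on the ball of radius p⁻¹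
about 1. -/
theorem exists_fixed (hr : 1 < r) {lam : ℂ_[p]} {f : RegularRatFunc p r} {G : ℂ_[p] → ℂ_[p]}
    (hG : SmallOnBall ((p : ℝ)⁻¹ ^ 2) G) (hf : ∀ z, ‖z‖ ≤ 1 →
      f.toFun z = lam / p * z ^ p + (1 - lam / p) * z ^ (p + 1) + G z)
    (hT : TameMap p f.toFun) : ∃ β, ‖β - 1‖ < 1 ∧ f.toFun β = β := by
  have hp : p.Prime := Fact.out
  have hp1 : (1 : ℝ) < p := by exact_mod_cast hp.one_lt
  have hi0 : 0 < (p : ℝ)⁻¹ := by positivity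
  have hi1 : (p : ℝ)⁻¹ < 1 := inv_lt_one_of_one_lt₀ hp1
  have hπ : (p : ℝ)⁻¹ ^ 2 < 1 := pow_lt_one₀ hi0.le hi1 two_ne_zero
  have hball : ∀ c : ℂ_[p], ‖c - 1‖ ≤ (p : ℝ)⁻¹ → ‖c‖ ≤ 1 := by
    intro c hc
    rw [← sub_add_cancel c 1]
    exact Ultra.norm_add_le_of_le (hc.trans hi1.le) norm_one.le
  have hrat : IsRatOn {c : ℂ_[p] | ‖c - 1‖ ≤ (p : ℝ)⁻¹} fun c => f.toFun c + -1 * c :=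
    (f.isRatOn_toFun (IsRatOn.id _) fun c hc => (hball c hc).trans hr.le).add
      ((IsRatOn.const _ (-1)).mul (IsRatOn.id _))
  have h1 : ‖f.toFun 1 - 1‖ < 1 := by
    rw [hf 1 norm_one.le, one_pow, one_pow, mul_one, mul_one, add_sub_cancel, add_sub_cancel_left]
    exact (hG.norm_le 1 norm_one.le).trans_lt hπ
  have hnp : ‖(p : ℂ_[p])‖ = (p : ℝ)⁻¹ := norm_natCast_prime
  have hexp := hT.expand (1 + p) 1 (by simpa [hnp] using hi1) (by simp)
  rw [add_sub_cancel_left, hnp, mul_inv_cancel₀ (by linarith)] at hexp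
  have h2 : ‖f.toFun 1 - 1 - p‖ < 1 := by
    rw [sub_eq_add_neg]
    exact norm_add_lt_of_lt h1 (by rwa [norm_neg, hnp])
  have h3 : ‖f.toFun (1 + p) + -1 * (1 + p) - 0‖ = 1 := by
    rw [show f.toFun (1 + p) + -1 * (1 + p) - 0
      = (f.toFun (1 + p) - f.toFun 1) + (f.toFun 1 - 1 - p) by ring,
      norm_add_eq_left_of_lt (by rwa [hexp]), hexp]
  obtain ⟨β, hβ, hfix⟩ := hrat.exists_eq (z := 1 + (p : ℂ_[p])) (y := 0)
    (by rw [add_sub_cancel_left, hnp]) (by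
      rw [h3, show f.toFun 1 + -1 * 1 - 0 = f.toFun 1 - 1 by ring]
      exact h1.ne')
  exact ⟨β, hβ.trans_lt hi1, by linear_combination hfix⟩

/-- The perturbation c z(z - β) vanishes at β and has size and Lipschitz constant at most |c| on the
unit ball; by the ultrametric inequality, adding it to f stays within the bound p⁻². -/
theorem exists_tameFamily (hr : 1 < r) {lam : ℂ_[p]} (hlam : ‖lam‖ = 1) {f : RegularRatFunc p r}
    (hf : edist f (benedettoMap p r lam) ≤ ENNReal.ofReal ((p : ℝ)⁻¹ ^ 2)) :
    ∃ β, TameFamily p (fun c => (f.addPoly (.C c * (.X * (.X - .C β)))).toFun) β := by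
  have hp : p.Prime := Fact.out
  have hp1 : (1 : ℝ) < p := by exact_mod_cast hp.one_lt
  have ha : ‖lam / (p : ℂ_[p])‖ = p := by
    rw [norm_div, hlam, norm_natCast_prime, one_div, inv_inv]
  obtain ⟨G, hG, hfG⟩ := exists_smallOnBall hr (by positivity) hf
  obtain ⟨β, hβ1, hβ⟩ := exists_fixed hr hG hfG
    (TameMap.of_smallOnBall ha hp norm_natCast_prime hG hfG)
  have hβn : ‖β‖ ≤ 1 := by
    rw [← sub_add_cancel β 1]
    exact Ultra.norm_add_le_of_le hβ1.le norm_one.le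
  have hval : ∀ c z : ℂ_[p], ‖z‖ ≤ 1 →
      (f.addPoly (.C c * (.X * (.X - .C β)))).toFun z = f.toFun z + c * (z * (z - β)) := by
    intro c z hz
    rw [toFun_addPoly _ _ (hz.trans hr.le)]
    simp
  refine ⟨β, hp, norm_natCast_prime, fun c hc => ?_, fun c c' z hz => ?_, fun c => ?_, hβ1,
    fun S φ ψ hφ hψ hb => ?_⟩
  · have hH : SmallOnBall ((p : ℝ)⁻¹ ^ 2) fun z => c * (z * (z - β)) := by
      refine ⟨fun z hz => ?_, fun z w hz hw => ?_⟩
      · rw [norm_mul, norm_mul]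
        exact (mul_le_of_le_one_right (norm_nonneg _) (mul_le_one₀ hz (norm_nonneg _)
          (Ultra.norm_sub_le_of_le hz hβn))).trans hc
      · rw [show c * (z * (z - β)) - c * (w * (w - β)) = c * ((z - w) * (z + w - β)) by ring,
          norm_mul, norm_mul]
        have h1 := Ultra.norm_sub_le_of_le (Ultra.norm_add_le_of_le hz hw) hβn
        exact mul_le_mul hc (mul_le_of_le_one_right (norm_nonneg _) h1) (by positivity)
          (by positivity)
    refine TameMap.of_smallOnBall ha hp norm_natCast_prime (hG.add hH) fun z hz => ?_
    rw [hval c z hz, hfG z hz, add_assoc]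
  · simp only [hval _ z hz]
    ring
  · simp only [hval c β hβn, hβ]
    ring
  · refine ((f.isRatOn_toFun hφ fun c hc => (hb c hc).trans hr.le).add
      (hψ.mul (hφ.mul (hφ.add (IsRatOn.const S (-β)))))).congr fun c hc => ?_
    rw [hval _ _ (hb c hc), sub_eq_add_neg]

/-- A disc whose images in the unit ball have diameter less than `1` and whose itinerary with
respect to the open unit ball is not eventually periodic is wandering and not attracted to a
cycle. -/
theorem mem_withWanderingDisc (hr : 1 ≤ r) {f : RegularRatFunc p r} {x₀ : ℂ_[p]} {m : ℕ}
    (hle : ∀ k, ‖f.toFun^[k] x₀‖ ≤ 1)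
    (hclose : ∀ x, ‖x - x₀‖ ≤ (p : ℝ)⁻¹ ^ m → ∀ k, ‖f.toFun^[k] x - f.toFun^[k] x₀‖ < 1)
    (hper : ∀ n₀ d, 0 < d →
      ¬ ∀ n, n₀ ≤ n → (‖f.toFun^[n] x₀‖ < 1 ↔ ‖f.toFun^[n + d] x₀‖ < 1)) :
    f ∈ withWanderingDisc p r := by
  have hnorm : ‖(p : ℂ_[p]) ^ m‖ = (p : ℝ)⁻¹ ^ m := by rw [norm_pow, norm_natCast_prime]
  have hp0 : (p : ℂ_[p]) ≠ 0 := by exact_mod_cast (Fact.out : p.Prime).ne_zero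
  have lt_iff : ∀ z w : ℂ_[p], ‖z - w‖ < 1 → (‖z‖ < 1 ↔ ‖w‖ < 1) := by
    intro z w h
    constructor
    · intro hz
      rw [← sub_sub_cancel z w, sub_eq_add_neg]
      exact norm_add_lt_of_lt hz (by rwa [norm_neg])
    · intro hw
      rw [← sub_add_cancel z w]
      exact norm_add_lt_of_lt h hw
  have mem : ∀ x ∈ Metric.closedBall x₀ ‖(p : ℂ_[p]) ^ m‖, ∀ k,
      ‖f.toFun^[k] x - f.toFun^[k] x₀‖ < 1 := by
    intro x hx
    rw [Metric.mem_closedBall, dist_eq_norm, hnorm] at hx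
    exact hclose x hx
  -- All points of the disc share one itinerary, so a meeting of the images at times n and n + d
  -- makes it d-periodic from n on.
  have key : ∀ n d, 0 < d → ∀ x ∈ Metric.closedBall x₀ ‖(p : ℂ_[p]) ^ m‖,
      ∀ y ∈ Metric.closedBall x₀ ‖(p : ℂ_[p]) ^ m‖, f.toFun^[n] x ≠ f.toFun^[n + d] y := by
    intro n d hd x hx y hy hxy
    refine hper n d hd fun j hj => ?_
    obtain ⟨i, rfl⟩ := Nat.exists_eq_add_of_le hj
    rw [← lt_iff _ _ (mem x hx (n + i)), ← lt_iff _ _ (mem y hy (n + i + d)), add_comm n i,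
      Function.iterate_add_apply, hxy, ← Function.iterate_add_apply,
      show i + (n + d) = i + n + d by ring]
  refine ⟨Metric.closedBall x₀ ‖(p : ℂ_[p]) ^ m‖, ⟨x₀, _, pow_ne_zero _ hp0, Or.inr rfl⟩,
    fun x hx n => ?_, fun n k ⟨z, ⟨x, hx, hxz⟩, ⟨y, hy, hyz⟩⟩ => ?_,
    Set.disjoint_left.2 fun x hx ⟨w, ⟨_, d, hd, hw, _⟩, hlim⟩ => ?_⟩
  · rw [← sub_add_cancel (f.toFun^[n] x) (f.toFun^[n] x₀)]
    exact (Ultra.norm_add_le_of_le (mem x hx n).le (hle n)).trans hr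
  · rcases lt_trichotomy n k with h | h | h
    · obtain ⟨d, rfl⟩ := Nat.exists_eq_add_of_lt h
      exact absurd (hxz.trans hyz.symm) (key n (d + 1) d.succ_pos x hx y hy)
    · exact h
    · obtain ⟨d, rfl⟩ := Nat.exists_eq_add_of_lt h
      exact absurd (hyz.trans hxz.symm) (key k (d + 1) d.succ_pos y hy x hx)
  · obtain ⟨n₀, hn₀⟩ := Filter.eventually_atTop.1 (hlim.eventually_lt_const one_pos)
    refine hper n₀ d hd fun n hn => ?_
    rw [← lt_iff _ _ (mem x hx n), ← lt_iff _ _ (mem x hx (n + d)), lt_iff _ _ (hn₀ n hn),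
      lt_iff _ _ (hn₀ (n + d) (by omega)), Function.iterate_add_apply f.toFun n d w, hw]

end RegularRatFunc

end

theorem mainTheorem4 (p : ℕ) [Fact p.Prime] (r : ℝ) (hr : 1 < r)
    (lam : ℂ_[p]) (hlam : ‖lam - 1‖ < 1) :
    benedettoMap p r lam ∈
      interior (closure (RegularRatFunc.withWanderingDisc p r)) := by
  have hlam1 : ‖lam‖ = 1 := by
    have := Ultra.norm_eq_of_norm_sub_lt (x := (1 : ℂ_[p])) (y := lam)
      (by rwa [norm_sub_rev, norm_one])
    rwa [norm_one] at this
  have hp0 : (0 : ℝ) < p := by exact_mod_cast (Fact.out : p.Prime).pos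
  rw [mem_interior_iff_mem_nhds, EMetric.mem_nhds_iff]
  refine ⟨ENNReal.ofReal ((p : ℝ)⁻¹ ^ 2), ENNReal.ofReal_pos.2 (by positivity), fun f hf => ?_⟩
  obtain ⟨β, F⟩ := RegularRatFunc.exists_tameFamily hr hlam1 (le_of_lt hf)
  rw [EMetric.mem_closure_iff]
  intro ε hε
  obtain ⟨δ, hδ, hδε⟩ : ∃ δ : ℝ, 0 < δ ∧ ENNReal.ofReal (δ * r ^ 2) < ε := by
    obtain ⟨e, he, heε⟩ := ENNReal.lt_iff_exists_nnreal_btwn.1 hε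
    have he0 : 0 < (e : ℝ) := by exact_mod_cast he
    -- Perturbing by c z(z - β) moves f by at most |c| r².
    refine ⟨e / r ^ 2, by positivity, ?_⟩
    rwa [div_mul_cancel₀ _ (by positivity), ENNReal.ofReal_coe_nnreal]
  obtain ⟨c, x₀, m, hc, hle, hclose, hper⟩ := F.exists_wandering hδ
  refine ⟨_, RegularRatFunc.mem_withWanderingDisc hr.le hle hclose hper,
    (RegularRatFunc.edist_addPoly_le hr f c β F.norm_fix.le).trans_lt (lt_of_le_of_lt ?_ hδε)⟩
  gcongr
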